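/- Let $1\le r\le d-1$ be integers, let $\mu$ be the normalized Haar (unitarily invariant) measure on the unit vectors $\psi\in\mathbb{C}^d$, put $\Pi_\psi=|\psi\rangle\langle\psi|$, and let the space of $d\times d$ matrices carry the Hilbert–Schmidt inner product, with $|A\rangle\!\rangle\langle\!\langle B|$ denoting the superoperator $X\mapsto \operatorname{tr}(B^\dagger X)A$. For a full-rank state $\rho$ write $p_\psi=\langle\psi|\rho|\psi\rangle$ and define, for the covariant measurement $\{d\,\Pi_\psi\,\mathrm{d}\mu(\psi)\}$: the frame superoperator $\mathcal{F}(\rho)=d\int \mathrm{d}\mu(\psi)\,p_\psi^{-1}|\Pi_\psi\rangle\!\rangle\langle\!\langle\Pi_\psi|$; the Fisher superoperator $\bar{\mathcal{F}}(\rho)=\bar{\mathbf I}\mathcal{F}(\rho)\bar{\mathbf I}$, where $\bar{\mathbf I}$ is the orthogonal projector onto traceless operators; the optimal reconstruction operators $\Theta_\psi=p_\psi^{-1}\mathcal{F}(\rho)^{-1}\Pi_\psi$; the scaled mean-square-error matrix $\mathcal{C}(\rho)=d\int \mathrm{d}\mu(\psi)\,p_\psi|\Theta_\psi\rangle\!\rangle\langle\!\langle\Theta_\psi|-|\rho\rangle\!\rangle\langle\!\langle\rho|$;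 the scaled mean-square error (MSE) $\mathcal{E}(\rho)=\operatorname{Tr}\mathcal{C}(\rho)$; the scaled mean-square Bures distance (MSB) $\mathcal{E}_{\mathrm{SB}}(\rho)=\operatorname{Tr}\{\mathcal{W}_\rho\,\mathcal{C}(\rho)\}$, where $\mathcal{W}_\rho(X)=\tfrac12 G$ with $\rho G+G\rho=X$ is the weighting matrix of the Bures metric; and the volume of the scaled uncertainty ellipsoid $\mathcal{V}(\rho)=V_{d^2-1}\sqrt{\bar{\operatorname{Det}}\,\mathcal{C}(\rho)}$, where $V_{d^2-1}=\pi^{(d^2-1)/2}/\Gamma(\tfrac{d^2+1}{2})$ and $\bar{\operatorname{Det}}$ is the determinant on the real space of traceless Hermitian operators. Let $\rho_r(s)=\frac{s}{r}\sum_{j=1}^r|j\rangle\langle j|+(1-s)\frac{1}{d}$ with $0\le s<1$, $\lambda_1=\frac{s}{r}+\frac{1-s}{d}$, $\lambda_2=\frac{1-s}{d}$, $E_{jk}=|j\rangle\langle k|$, and $a=g_{20}$, $b=g_{11}$, $c=g_{02}$, where $$g_{jk}=\frac{2dr\,\Gamma(d+1)}{\Gamma(r+j)\Gamma(d-r+k)}\int_0^{\pi/2}\mathrm{d}\alpha\,\frac{(\cos\alpha)^{2r-1+2j}(\sin\alpha)^{2d-2r-1+2k}}{ds(\cos\alpha)^2+r(1-s)},$$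 $$\beta=\frac{(r+1)(d-r)a+r(d-r+1)c-2r(d-r)b}{d}.$$ Then the following hold. (1) $a,b,c,\beta>0$, $\mathcal{F}(\rho_r(s))$ is invertible, and $$\mathcal{F}(\rho_r(s))=a\mathcal{P}_1+b\mathcal{P}_2+c\mathcal{P}_3+\sum_{j,k}\mathcal{M}_{jk}|E_{jj}\rangle\!\rangle\langle\!\langle E_{kk}|,$$ where $\mathcal{P}_1$, $\mathcal{P}_3$, $\mathcal{P}_2$ are the orthogonal projectors onto the spans of the $E_{jk}$ with, respectively, $j\neq k\le r$; $j\ne k$ both $>r$; and exactly one of $j,k$ at most $r$; and $\mathcal{M}_{jk}$ is $(1+\delta_{jk})a$ if $j,k\le r$, $(1+\delta_{jk})c$ if $j,k>r$, and $b$ otherwise. $\bar{\mathcal F}(\rho_r(s))$ has the same form with $\mathcal{M}$ replaced by $\bar{\mathcal M}=\bar I\mathcal{M}\bar I$, where $\bar I$ is the $d\times d$ matrix with entries $\delta_{jk}-1/d$. (2) $\bar{\mathcal M}$ is symmetric; apart from the eigenvalue $0$ of the all-ones vector, it has the eigenvalues $a$, $c$, $\beta$ with multiplicities $r-1$, $d-r-1$,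 $1$. For $j\ne k$ the operators $E_{jk}^{+}=\frac{1}{\sqrt2}(E_{jk}+E_{kj})$ and $E_{jk}^{-}=-\frac{\mathrm i}{\sqrt2}(E_{jk}-E_{kj})$ are eigenvectors of $\mathcal F(\rho_r(s))$ and $\bar{\mathcal F}(\rho_r(s))$, with eigenvalue $a$ if $j,k\le r$, $c$ if $j,k>r$, and $b$ otherwise. $\bar{\mathcal F}(\rho_r(s))$ is Hermitian, annihilates the identity, maps traceless Hermitian operators to traceless Hermitian operators, and on this space has the eigenvalues $a,b,c,\beta$ with multiplicities $r^2-1$, $2r(d-r)$, $(d-r)^2-1$ and $1$ (multiplicities add up if some of the four values coincide). (3) $$\mathcal{E}(\rho_r(s))=\frac{r^2-1}{a}+\frac{2r(d-r)}{b}+\frac{(d-r)^2-1}{c}+\frac1\beta,$$ $$\mathcal{E}_{\mathrm{SB}}(\rho_r(s))=\frac14\Bigl(\frac{r^2-1}{a\lambda_1}+\frac{4r(d-r)}{b(\lambda_1+\lambda_2)}+\frac{(d-r)^2-1}{c\lambda_2}+\frac{d-r}{d\beta\lambda_1}+\frac{r}{d\beta\lambda_2}\Bigr),$$ $$\mathcal{V}(\rho_r(s))=V_{d^2-1}\bigl(a^{r^2-1}b^{2r(d-r)}c^{(d-r)^2-1}\beta\bigr)^{-1/2},$$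 $$\ln\mathcal{V}(\rho_r(s))=\ln V_{d^2-1}-\tfrac12\bigl\{(r^2-1)\ln a+2r(d-r)\ln b+[(d-r)^2-1]\ln c+\ln\beta\bigr\}.$$ (4) For every integer $m\ge0$ and every $u>0$, $$\int_0^{\pi/2}\mathrm{d}\alpha\,\frac{\cos\alpha(\sin\alpha)^{2m+1}}{(\cos\alpha)^2+u}=\frac12(1+u)^m\ln\frac{1+u}{u}-\frac12\sum_{n=0}^{m-1}\frac{(1+u)^n}{m-n}.$$ (5) If $r\ge2$, then as $s\to1^-$ one has $a\to\frac{r}{r+1}$, $b\to1$, $c\to\frac{r}{r-1}$, and $$\mathcal{E}(\rho_r(s))\to d^2+2d-1-\frac{d^2}{r}-\frac1r .$$ -/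

import Mathlib

open Matrix MeasureTheory Filter Topology

noncomputable section

namespace CovTomo

/-- Operators on the `d`-dimensional Hilbert space `ℂ^d`. -/
abbrev Op (d : ℕ) : Type := Matrix (Fin d) (Fin d) ℂ

/-- Superoperators: linear maps on operators. -/
abbrev SuperOp (d : ℕ) : Type := Module.End ℂ (Op d)

/-- The operator `E_{jk} = |j⟩⟨k|` of the standard basis. -/
def E {d : ℕ} (j k : Fin d) : Op d := Matrix.single j k 1

/-- `E_{jk}^+ = (|j⟩⟨k| + |k⟩⟨j|) / √2`. -/
def Eplus {d : ℕ} (j k : Fin d) : Op d := ((1 / √2 : ℝ) : ℂ) • (E j k + E k j)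

/-- `E_{jk}^- = -i (|j⟩⟨k| - |k⟩⟨j|) / √2`. -/
def Eminus {d : ℕ} (j k : Fin d) : Op d := (-Complex.I * ((1 / √2 : ℝ) : ℂ)) • (E j k - E k j)

/-- The superoperator `|A⟩⟩⟨⟨B|`, i.e. `X ↦ tr(Bᴴ X) A`. -/
def dOuter {d : ℕ} (A B : Op d) : SuperOp d where
  toFun X := (Bᴴ * X).trace • A
  map_add' X Y := by rw [Matrix.mul_add, Matrix.trace_add, add_smul]
  map_smul' c X := by
    rw [Matrix.mul_smul, Matrix.trace_smul, smul_eq_mul, mul_smul, RingHom.id_apply]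

/-- Unit vectors of `ℂ^d`. -/
abbrev PureState (d : ℕ) : Type := Metric.sphere (0 : EuclideanSpace ℂ (Fin d)) 1

/-- The normalized (unitarily invariant) Haar measure on the unit vectors of `ℂ^d`. -/
def haarPure (d : ℕ) : Measure (PureState d) :=
  ((volume : Measure (EuclideanSpace ℂ (Fin d))).toSphere Set.univ)⁻¹ •
    (volume : Measure (EuclideanSpace ℂ (Fin d))).toSphere

/-- The projector `Π_ψ = |ψ⟩⟨ψ|`. -/
def ketbra {d : ℕ} (ψ : PureState d) : Op d :=
  Matrix.of fun i j => ψ.1 i * star (ψ.1 j)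

/-- `⟨ψ|ρ|ψ⟩ = tr(Π_ψ ρ)`. -/
def born {d : ℕ} (ρ : Op d) (ψ : PureState d) : ℝ := (ketbra ψ * ρ).trace.re

/-- The integral `∫ dμ(ψ) T(ψ)` of a superoperator-valued function over the pure states, computed
entrywise in the orthonormal operator basis `E_{jk}`. -/
def haarIntegral {d : ℕ} (T : PureState d → SuperOp d) : SuperOp d :=
  ∑ i, ∑ j, ∑ k, ∑ l, (∫ ψ, T ψ (E k l) i j ∂haarPure d) • dOuter (E i j) (E k l)

/-- The frame superoperator of the covariant measurement,
`F(ρ) = d ∫ dμ(ψ) ⟨ψ|ρ|ψ⟩⁻¹ |Π_ψ⟩⟩⟨⟨Π_ψ|`. -/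
def frame {d : ℕ} (ρ : Op d) : SuperOp d :=
  (d : ℂ) • haarIntegral fun ψ => (((born ρ ψ)⁻¹ : ℝ) : ℂ) • dOuter (ketbra ψ) (ketbra ψ)

/-- The projector `Ī` onto the traceless operators. -/
def tracelessProj (d : ℕ) : SuperOp d := 1 - ((d : ℂ)⁻¹) • dOuter 1 1

/-- The Fisher information superoperator `F̄(ρ) = Ī F(ρ) Ī`. -/
def fisher {d : ℕ} (ρ : Op d) : SuperOp d := tracelessProj d * frame ρ * tracelessProj d

/-- The scaled mean-square-error matrix of the linear estimator with reconstruction operators `Θ_ψ`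
for the covariant measurement, `d ∫ dμ(ψ) |Θ_ψ⟩⟩ ⟨ψ|ρ|ψ⟩ ⟨⟨Θ_ψ| - |ρ⟩⟩⟨⟨ρ|`. -/
def mseMatrix {d : ℕ} (ρ : Op d) (Θ : PureState d → Op d) : SuperOp d :=
  (d : ℂ) • haarIntegral (fun ψ => ((born ρ ψ : ℝ) : ℂ) • dOuter (Θ ψ) (Θ ψ)) - dOuter ρ ρ

/-- The optimal reconstruction operators `Θ_ψ = ⟨ψ|ρ|ψ⟩⁻¹ F(ρ)⁻¹ Π_ψ`. -/
def optRec {d : ℕ} (ρ : Op d) (ψ : PureState d) : Op d :=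
  (((born ρ ψ)⁻¹ : ℝ) : ℂ) • (Ring.inverse (frame ρ)) (ketbra ψ)

/-- The scaled mean-square-error matrix `C(ρ)` of the best linear unbiased estimator. -/
def blueMatrix {d : ℕ} (ρ : Op d) : SuperOp d := mseMatrix ρ (optRec ρ)

/-- The scaled weighted mean-square error `Tr(W C(ρ))` (`W` and `C(ρ)` are Hermitian, so that this
trace is real). -/
def scaledWMSE {d : ℕ} (W : SuperOp d) (ρ : Op d) : ℝ :=
  (LinearMap.trace ℂ (Op d) (W * blueMatrix ρ)).re

/-- The scaled mean-square error with respect to the Hilbert-Schmidt distance. -/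
def scaledMSE {d : ℕ} (ρ : Op d) : ℝ := scaledWMSE 1 ρ

/-- The weighting matrix of the Bures metric `D_B²(ρ, ρ + dρ) = tr(dρ G) / 2`, where `G` is the
solution of `ρ G + G ρ = dρ`. In an eigenbasis of `ρ` with eigenvalues `λ_j > 0` this is
`D_B²(ρ, ρ + dρ) = (1/2) ∑_{j,k} |⟨j|dρ|k⟩|² / (λ_j + λ_k)`. -/
def buresWeight {d : ℕ} (ρ : Op d) : SuperOp d :=
  (1 / 2 : ℂ) • Ring.inverse (LinearMap.mulLeft ℂ ρ + LinearMap.mulRight ℂ ρ)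

/-- The scaled mean-square Bures distance. -/
def scaledMSB {d : ℕ} (ρ : Op d) : ℝ := scaledWMSE (buresWeight ρ) ρ

/-- The real vector space of traceless Hermitian operators. -/
def tracelessHerm (d : ℕ) : Submodule ℝ (Op d) where
  carrier := {X | X.IsHermitian ∧ X.trace = 0}
  add_mem' hX hY := ⟨hX.1.add hY.1, by rw [Matrix.trace_add, hX.2, hY.2, add_zero]⟩
  zero_mem' := ⟨Matrix.isHermitian_zero, Matrix.trace_zero _ _⟩
  smul_mem' c X hX := ⟨by
    change (c • X)ᴴ = c • X
    rw [Matrix.conjTranspose_smul, hX.1.eq, star_trivial], by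
    rw [Matrix.trace_smul, hX.2, smul_zero]⟩

/-- The orthogonal projection `X ↦ (X + Xᴴ)/2 - (Re tr X / d) 1` onto the traceless Hermitian
operators. -/
def tracelessHermProj (d : ℕ) : Op d →ₗ[ℝ] tracelessHerm d where
  toFun X := ⟨(1 / 2 : ℝ) • (X + Xᴴ) - (X.trace.re / d) • (1 : Op d), by
    constructor
    · change (_ : Op d)ᴴ = _
      simp [Matrix.conjTranspose_smul, add_comm]
    · rcases Nat.eq_zero_or_pos d with rfl | hd
      · simp [Matrix.trace]
      · have hd' : (d : ℂ) ≠ 0 := by exact_mod_cast hd.ne'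
        rw [Matrix.trace_sub, Matrix.trace_smul, Matrix.trace_smul, Matrix.trace_add,
          Matrix.trace_conjTranspose, Matrix.trace_one, Fintype.card_fin]
        apply Complex.ext
        · have hd2 : (d : ℝ) ≠ 0 := by exact_mod_cast hd.ne'
          simp
          field_simp
          ring
        · simp⟩
  map_add' X Y := by
    apply Subtype.ext
    simp only [Submodule.coe_add, Matrix.conjTranspose_add, Matrix.trace_add, Complex.add_re,
      add_div, add_smul, smul_add]
    abel
  map_smul' c X := by
    apply Subtype.ext
    simp only [Submodule.coe_smul, Matrix.conjTranspose_smul, star_trivial, Matrix.trace_smul,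
      Complex.smul_re, smul_eq_mul, RingHom.id_apply, smul_sub, smul_add, smul_smul,
      mul_div_assoc, mul_comm]

/-- The restriction of a superoperator to the real space of traceless Hermitian operators (the
projection acts trivially if the superoperator leaves this space invariant). -/
def restrictTH {d : ℕ} (O : SuperOp d) : Module.End ℝ (tracelessHerm d) :=
  tracelessHermProj d ∘ₗ O.restrictScalars ℝ ∘ₗ (tracelessHerm d).subtype

/-- The volume `V_{d²-1}` of the unit ball of dimension `d² - 1`. -/
def ballVol (d : ℕ) : ℝ := Real.pi ^ (((d : ℝ) ^ 2 - 1) / 2) / Real.Gamma (((d : ℝ) ^ 2 + 1) / 2)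

/-- The volume of the scaled uncertainty ellipsoid, `V_{d²-1} √(Det C(ρ))`, with the determinant
taken on the traceless Hermitian operators. -/
def ellipsoidVol {d : ℕ} (ρ : Op d) : ℝ :=
  ballVol d * √(LinearMap.det (restrictTH (blueMatrix ρ)))

/-- `ρ_r(s) = (s/r) ∑_{j ≤ r} |j⟩⟨j| + (1-s)/d`; the `r` basis vectors are those of index `< r`
in `Fin d`. -/
def rhoState (d r : ℕ) (s : ℝ) : Op d :=
  ((s / r : ℝ) : ℂ) • (∑ j : Fin d with j.val < r, E j j) + (((1 - s) / d : ℝ) : ℂ) • (1 : Op d)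

/-- The integrals `g_{jk}`. -/
def g (d r : ℕ) (s : ℝ) (j k : ℕ) : ℝ :=
  2 * d * r * Real.Gamma (d + 1) / (Real.Gamma (r + j) * Real.Gamma ((d : ℝ) - r + k)) *
    ∫ α in (0 : ℝ)..(Real.pi / 2),
      Real.cos α ^ (2 * r - 1 + 2 * j) * Real.sin α ^ (2 * d - 2 * r - 1 + 2 * k) /
        (d * s * Real.cos α ^ 2 + r * (1 - s))

/-- `a = g_{20}`. -/
def aPar (d r : ℕ) (s : ℝ) : ℝ := g d r s 2 0

/-- `b = g_{11}`. -/
def bPar (d r : ℕ) (s : ℝ) : ℝ := g d r s 1 1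

/-- `c = g_{02}`. -/
def cPar (d r : ℕ) (s : ℝ) : ℝ := g d r s 0 2

/-- `β = ((r+1)(d-r) a + r(d-r+1) c - 2r(d-r) b) / d`. -/
def betaPar (d r : ℕ) (s : ℝ) : ℝ :=
  ((r + 1) * (d - r) * aPar d r s + r * (d - r + 1) * cPar d r s
    - 2 * r * (d - r) * bPar d r s) / d

/-- The projector onto the span of the `E_{jk}` with `j ≠ k` both in the first block. -/
def P1 (d r : ℕ) : SuperOp d :=
  ∑ j : Fin d, ∑ k : Fin d, if j ≠ k ∧ j.val < r ∧ k.val < r then dOuter (E j k) (E j k) else 0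

/-- The projector onto the span of the `E_{jk}`, `E_{kj}` with `j` in the first and `k` in the
second block. -/
def P2 (d r : ℕ) : SuperOp d :=
  ∑ j : Fin d, ∑ k : Fin d,
    if j.val < r ∧ r ≤ k.val then dOuter (E j k) (E j k) + dOuter (E k j) (E k j) else 0

/-- The projector onto the span of the `E_{jk}` with `j ≠ k` both in the second block. -/
def P3 (d r : ℕ) : SuperOp d :=
  ∑ j : Fin d, ∑ k : Fin d, if j ≠ k ∧ r ≤ j.val ∧ r ≤ k.val then dOuter (E j k) (E j k) else 0

/-- The common value `a`, `b` or `c` attached to a pair of indices by the blocks they lie in. -/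
def blockVal (d r : ℕ) (s : ℝ) (j k : Fin d) : ℝ :=
  if j.val < r ∧ k.val < r then aPar d r s
  else if r ≤ j.val ∧ r ≤ k.val then cPar d r s
  else bPar d r s

/-- The matrix `M`: `(1+δ_{jk}) a` on the first block, `(1+δ_{jk}) c` on the second block and `b`
elsewhere. -/
def Mmat (d r : ℕ) (s : ℝ) : Matrix (Fin d) (Fin d) ℝ :=
  Matrix.of fun j k => (1 + if j = k then 1 else 0) * blockVal d r s j k

/-- The `d × d` matrix of `Ī` on diagonal operators. -/
def Ibar (d : ℕ) : Matrix (Fin d) (Fin d) ℝ := 1 - (d : ℝ)⁻¹ • Matrix.of fun _ _ => 1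

/-- `M̄ = Ī M Ī`. -/
def Mbar (d r : ℕ) (s : ℝ) : Matrix (Fin d) (Fin d) ℝ := Ibar d * Mmat d r s * Ibar d

/-- `∑_{j,k} N_{jk} |E_{jj}⟩⟩⟨⟨E_{kk}|`. -/
def diagSuper {d : ℕ} (N : Matrix (Fin d) (Fin d) ℝ) : SuperOp d :=
  ∑ j, ∑ k, ((N j k : ℝ) : ℂ) • dOuter (E j j) (E k k)

/-- The larger eigenvalue `λ₁ = s/r + (1-s)/d` of `ρ_r(s)`. -/
def lam1 (d r : ℕ) (s : ℝ) : ℝ := s / r + (1 - s) / d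

/-- The smaller eigenvalue `λ₂ = (1-s)/d` of `ρ_r(s)`. -/
def lam2 (d : ℕ) (s : ℝ) : ℝ := (1 - s) / d

end CovTomo

end

/-!
The weight `p_ψ⁻¹` is removed by writing `p⁻¹ = (d + 1) ∫₀^∞ (1 + z p) ^ (-(d + 2)) dz`. On the
unit sphere `1 + z p_ψ` is the quadratic form `∑ m, (1 + z w_m) |ψ_m|²`, where `w_m` are the
eigenvalues of the state, and integrating a Gaussian in polar coordinates expresses the Haar
moments of monomials against powers of a quadratic form as products over `m`. Hence the frame
superoperator of a diagonal state multiplies each off-diagonal entry by a number and acts on the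
diagonal by a matrix; for `ρ_r(s)` the numbers are the half-line integrals
`∫₀^∞ (1 + λ₁ z) ^ (-(r + j)) (1 + λ₂ z) ^ (-(d - r + k)) dz`, which Feynman's formula identifies
with `g_{jk}`.

By its block structure the Fisher superoperator lies in a commutative algebra isomorphic to `ℝ⁴`,
with coordinates `a`, `b`, `c`, `β`. Multiplicities of eigenvalues are the traces of the four
primitive idempotents, and determinants and characteristic polynomials follow from them. Since
`F(ρ) ρ = 1` and `F(ρ)` is symmetric, `F(ρ)⁻¹ = G + |ρ⟩⟩⟨⟨ρ|` with `G` the inverse of `F̄(ρ)` on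
the traceless operators, so that the mean-square-error matrix is `G`, with coordinates `a⁻¹`,
`b⁻¹`, `c⁻¹`, `β⁻¹`.
-/

noncomputable section

namespace CovTomo

/-! ### Gaussian integrals and moments of Haar measure -/

/-- The integrand `z ^ p * conj z ^ q * exp (-b |z|²)` of a Gaussian moment on `ℂ`. -/
def gaussMonomial (p q : ℕ) (b : ℝ) (z : ℂ) : ℂ :=
  z ^ p * star z ^ q * ((Real.exp (-b * ‖z‖ ^ 2) : ℝ) : ℂ)

lemma continuous_gaussMonomial (p q : ℕ) (b : ℝ) : Continuous (gaussMonomial p q b) := by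
  unfold gaussMonomial
  fun_prop

lemma integrable_gaussMonomial (p q : ℕ) {b : ℝ} (hb : 0 < b) :
    Integrable (gaussMonomial p q b) := by
  have hradial : IntegrableOn
      (fun t : ℝ => t ^ (Module.finrank ℝ ℂ - 1) • (t ^ (p + q) * Real.exp (-b * t ^ 2)))
      (Set.Ioi 0) := by
    refine (integrableOn_rpow_mul_exp_neg_mul_sq hb (s := ((p + q + 1 : ℕ) : ℝ))
      (neg_one_lt_zero.trans_le (Nat.cast_nonneg _))).congr_fun (fun t _ => ?_) measurableSet_Ioi
    simp only [Real.rpow_natCast, Complex.finrank_real_complex, smul_eq_mul]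
    ring
  refine ((integrable_fun_norm_addHaar volume).2 hradial).mono'
    (continuous_gaussMonomial p q b).aestronglyMeasurable (Eventually.of_forall fun z => ?_)
  rw [gaussMonomial, norm_mul, norm_mul, norm_pow, norm_pow, norm_star, Complex.norm_real,
    Real.norm_eq_abs, abs_of_pos (Real.exp_pos _), pow_add]

lemma gaussMonomial_circle_mul (p q : ℕ) (b : ℝ) (c : Circle) (z : ℂ) :
    gaussMonomial p q b (c * z) = (c : ℂ) ^ p * star (c : ℂ) ^ q * gaussMonomial p q b z := by
  simp only [gaussMonomial, norm_mul, Circle.norm_coe, one_mul, star_mul', mul_pow]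
  ring

lemma exists_circle_pow_mul_star_pow_eq_neg_one {p q : ℕ} (hpq : p ≠ q) :
    ∃ c : Circle, (c : ℂ) ^ p * star (c : ℂ) ^ q = -1 := by
  have hne : (p : ℂ) - q ≠ 0 := sub_ne_zero.2 (Nat.cast_injective.ne hpq)
  refine ⟨Circle.exp (Real.pi / ((p : ℝ) - q)), ?_⟩
  rw [Complex.star_def, ← Circle.coe_inv_eq_conj, ← Circle.exp_neg, Circle.coe_exp, Circle.coe_exp,
    ← Complex.exp_nat_mul, ← Complex.exp_nat_mul, ← Complex.exp_add, ← Complex.exp_pi_mul_I]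
  congr 1
  push_cast
  field_simp
  ring

lemma integral_gaussMonomial_of_ne {p q : ℕ} (hpq : p ≠ q) (b : ℝ) :
    ∫ z, gaussMonomial p q b z = 0 := by
  obtain ⟨c, hc⟩ := exists_circle_pow_mul_star_pow_eq_neg_one hpq
  have hinv : ∫ z, gaussMonomial p q b (c * z) = ∫ z, gaussMonomial p q b z :=
    (rotation c).measurePreserving.integral_comp
      (rotation c).toHomeomorph.measurableEmbedding (gaussMonomial p q b)
  simp only [gaussMonomial_circle_mul, hc, neg_one_mul, integral_neg] at hinv
  exact self_eq_neg.1 hinv.symm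

lemma integral_gaussMonomial_self (p : ℕ) {b : ℝ} (hb : 0 < b) :
    ∫ z, gaussMonomial p p b z = ((Real.pi * (p.factorial / b ^ (p + 1)) : ℝ) : ℂ) := by
  have hradial (z : ℂ) : gaussMonomial p p b z
      = ((‖z‖ ^ ((2 * p : ℕ) : ℝ) * Real.exp (-b * ‖z‖ ^ (2 : ℝ)) : ℝ) : ℂ) := by
    rw [gaussMonomial, ← mul_pow, Complex.star_def, Complex.mul_conj, Complex.normSq_eq_norm_sq,
      Real.rpow_natCast, Real.rpow_two, pow_mul]
    push_cast
    rfl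
  have hexp : (((2 * p : ℕ) : ℝ) + 2) / 2 = ((p + 1 : ℕ) : ℝ) := by push_cast; ring
  simp_rw [hradial]
  rw [integral_complex_ofReal, Complex.integral_rpow_mul_exp_neg_mul_rpow one_le_two
    (by push_cast; linarith [p.cast_nonneg (α := ℝ)]) hb, neg_div, hexp, Real.rpow_neg hb.le,
    Real.rpow_natCast, Nat.cast_succ, Real.Gamma_nat_eq_factorial]
  congr 1
  field_simp

lemma integral_gaussMonomial (p q : ℕ) {b : ℝ} (hb : 0 < b) :
    ∫ z, gaussMonomial p q b z =
      ((Real.pi * if p = q then p.factorial / b ^ (p + 1) else 0 : ℝ) : ℂ) := by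
  split_ifs with hpq
  · exact hpq ▸ integral_gaussMonomial_self p hb
  · rw [integral_gaussMonomial_of_ne hpq, mul_zero, Complex.ofReal_zero]

lemma integral_pow_mul_exp_neg_mul_sq (n : ℕ) {b : ℝ} (hb : 0 < b) :
    ∫ t in Set.Ioi (0 : ℝ), t ^ (2 * n + 1) * Real.exp (-b * t ^ 2)
      = n.factorial / (2 * b ^ (n + 1)) := by
  have h := integral_rpow_mul_exp_neg_mul_rpow (p := 2) (q := ((2 * n + 1 : ℕ) : ℝ)) two_pos
    (by push_cast; linarith [n.cast_nonneg (α := ℝ)]) hb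
  have hexp : (((2 * n + 1 : ℕ) : ℝ) + 1) / 2 = ((n + 1 : ℕ) : ℝ) := by push_cast; ring
  simp only [Real.rpow_natCast, Real.rpow_two] at h
  rw [h, neg_div, hexp, Real.rpow_neg hb.le, Real.rpow_natCast, Nat.cast_succ,
    Real.Gamma_nat_eq_factorial]
  field_simp

section PolarCoordinates

variable {V : Type*} [NormedAddCommGroup V] [NormedSpace ℝ V] [MeasurableSpace V]

lemma toSphere_smul (c : ENNReal) (μ : Measure V) : (c • μ).toSphere = c • μ.toSphere := by
  simp only [Measure.toSphere, Measure.fst, Measure.comap_smul, Measure.restrict_smul,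
    Measure.map_smul, smul_comm c]

variable [BorelSpace V] [FiniteDimensional ℝ V] [Nontrivial V]

lemma integral_eq_integral_toSphere {F : Type*} [NormedAddCommGroup F] [NormedSpace ℝ F]
    (μ : Measure V) [μ.IsAddHaarMeasure] {f : V → F} (hf : Integrable f μ) :
    ∫ x, f x ∂μ = ∫ ω : Metric.sphere (0 : V) 1, (∫ t in Set.Ioi (0 : ℝ),
      t ^ (Module.finrank ℝ V - 1) • f (t • (ω : V))) ∂μ.toSphere := by
  have hpres := μ.measurePreserving_homeomorphUnitSphereProd
  have hemb := (homeomorphUnitSphereProd V).measurableEmbedding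
  let polar : Metric.sphere (0 : V) 1 × Set.Ioi (0 : ℝ) → F := fun y => f (y.2.1 • (y.1 : V))
  have hpolar (x : ({0}ᶜ : Set V)) : polar (homeomorphUnitSphereProd V x) = f x := by
    have hx : ‖(x : V)‖ ≠ 0 := norm_ne_zero_iff.2 x.2
    simp [polar, smul_smul, hx]
  have hint : Integrable polar
      (μ.toSphere.prod (.volumeIoiPow (Module.finrank ℝ V - 1))) := by
    rw [← hpres.integrable_comp_emb hemb, show polar ∘ homeomorphUnitSphereProd V = f ∘ Subtype.val
      from funext hpolar, ← integrableOn_iff_comap_subtypeVal (measurableSet_singleton _).compl]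
    exact hf.integrableOn
  calc ∫ x, f x ∂μ = ∫ y, polar y ∂(μ.toSphere.prod (.volumeIoiPow (Module.finrank ℝ V - 1))) := by
        rw [← hpres.integral_comp hemb]
        simp_rw [hpolar]
        rw [integral_subtype_comap (measurableSet_singleton _).compl, restrict_compl_singleton]
    _ = _ := by
        rw [integral_prod _ hint]
        congr 1
        funext ω
        simp only [Measure.volumeIoiPow, ENNReal.ofReal, polar]
        rw [integral_withDensity_eq_integral_smul
            (measurable_subtype_coe.pow_const _).real_toNNReal,
          integral_subtype_comap measurableSet_Ioi
            fun a : ℝ ↦ Real.toNNReal (a ^ (Module.finrank ℝ V - 1)) • f (a • (ω : V))]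
        refine setIntegral_congr_fun measurableSet_Ioi fun t ht => ?_
        simp only [NNReal.smul_def, Real.coe_toNNReal _ (pow_nonneg (le_of_lt ht) _)]

end PolarCoordinates

section HaarMoments

variable {ι : Type*}

lemma measurableEmbedding_toLp [Countable ι] :
    MeasurableEmbedding (PiLp.continuousLinearEquiv 2 ℝ fun _ : ι => ℂ).symm :=
  (PiLp.continuousLinearEquiv 2 ℝ fun _ : ι => ℂ).symm.toHomeomorph.measurableEmbedding

variable [Fintype ι]

/-- The monomial `∏ m, x_m ^ p_m * conj x_m ^ q_m`. -/
def monomial (p q : ι → ℕ) (x : EuclideanSpace ℂ ι) : ℂ :=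
  ∏ m, x m ^ p m * star (x m) ^ q m

/-- The quadratic form `∑ m, w_m |x_m|²`. -/
def weightedNormSq (w : ι → ℝ) (x : EuclideanSpace ℂ ι) : ℝ := ∑ m, w m * ‖x m‖ ^ 2

lemma continuous_monomial (p q : ι → ℕ) : Continuous (monomial p q) := by
  unfold monomial
  fun_prop

lemma continuous_weightedNormSq (w : ι → ℝ) : Continuous (weightedNormSq w) := by
  unfold weightedNormSq
  fun_prop

lemma weightedNormSq_one_sphere (ω : Metric.sphere (0 : EuclideanSpace ℂ ι) 1) :
    weightedNormSq 1 ω.1 = 1 := by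
  simp only [weightedNormSq, Pi.one_apply, one_mul, ← EuclideanSpace.norm_sq_eq,
    norm_eq_of_mem_sphere ω, one_pow]

lemma weightedNormSq_pos {w : ι → ℝ} (hw : ∀ m, 0 < w m) {x : EuclideanSpace ℂ ι} (hx : x ≠ 0) :
    0 < weightedNormSq w x := by
  obtain ⟨m, hm⟩ : ∃ m, x m ≠ 0 := by
    contrapose! hx
    exact PiLp.ext hx
  have := hw m
  exact Finset.sum_pos' (fun n _ => mul_nonneg (hw n).le (sq_nonneg _))
    ⟨m, Finset.mem_univ m, by positivity⟩

lemma weightedNormSq_sphere_pos {w : ι → ℝ} (hw : ∀ m, 0 < w m)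
    (ω : Metric.sphere (0 : EuclideanSpace ℂ ι) 1) : 0 < weightedNormSq w ω.1 :=
  weightedNormSq_pos hw (ne_zero_of_mem_unit_sphere ω)

lemma le_weightedNormSq_sphere {w : ι → ℝ} {l : ℝ} (hl : ∀ m, l ≤ w m)
    (ω : Metric.sphere (0 : EuclideanSpace ℂ ι) 1) : l ≤ weightedNormSq w ω.1 := by
  have h := weightedNormSq_one_sphere ω
  calc l = l * weightedNormSq 1 ω.1 := by rw [h, mul_one]
    _ = ∑ m, l * ‖ω.1 m‖ ^ 2 := by simp [weightedNormSq, Finset.mul_sum]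
    _ ≤ weightedNormSq w ω.1 := by
      rw [weightedNormSq]
      gcongr with m
      exact hl m

lemma weightedNormSq_one_add_mul_sphere (w : ι → ℝ) (z : ℝ)
    (ω : Metric.sphere (0 : EuclideanSpace ℂ ι) 1) :
    weightedNormSq (fun m => 1 + z * w m) ω.1 = 1 + z * weightedNormSq w ω.1 := by
  have h := weightedNormSq_one_sphere ω
  simp only [weightedNormSq, Pi.one_apply, one_mul] at h
  simp only [weightedNormSq, add_mul, one_mul, Finset.sum_add_distrib, h, mul_assoc,
    Finset.mul_sum]

lemma monomial_smul (p q : ι → ℕ) (t : ℝ) (x : EuclideanSpace ℂ ι) :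
    monomial p q (t • x) = (t : ℂ) ^ (∑ m, (p m + q m)) * monomial p q x := by
  unfold monomial
  rw [← Finset.prod_pow_eq_pow_sum, ← Finset.prod_mul_distrib]
  refine Finset.prod_congr rfl fun m _ => ?_
  simp only [PiLp.smul_apply, Complex.real_smul, star_mul', Complex.star_def, Complex.conj_ofReal]
  ring

lemma weightedNormSq_smul (w : ι → ℝ) (t : ℝ) (x : EuclideanSpace ℂ ι) :
    weightedNormSq w (t • x) = weightedNormSq w x * t ^ 2 := by
  simp only [weightedNormSq, Finset.sum_mul, PiLp.smul_apply, norm_smul, mul_pow,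
    Real.norm_eq_abs, sq_abs]
  exact Finset.sum_congr rfl fun m _ => by ring

lemma monomial_mul_exp_weightedNormSq (p q : ι → ℕ) (w : ι → ℝ) (x : EuclideanSpace ℂ ι) :
    monomial p q x * ((Real.exp (-weightedNormSq w x) : ℝ) : ℂ)
      = ∏ m, gaussMonomial (p m) (q m) (w m) (x m) := by
  unfold monomial weightedNormSq gaussMonomial
  rw [← Finset.sum_neg_distrib, Real.exp_sum, Complex.ofReal_prod, ← Finset.prod_mul_distrib]
  simp_rw [neg_mul]

variable (ι) in
/-- Lebesgue measure on `ℂ^ι` as a product measure. As an invariant measure it differs from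
`volume` by a constant factor only, which the normalization of `haarPure` cancels. -/
def prodVolume : Measure (EuclideanSpace ℂ ι) :=
  Measure.map (PiLp.continuousLinearEquiv 2 ℝ fun _ : ι => ℂ).symm volume

instance isAddHaarMeasure_prodVolume : (prodVolume ι).IsAddHaarMeasure :=
  (PiLp.continuousLinearEquiv 2 ℝ fun _ : ι => ℂ).symm.isAddHaarMeasure_map volume

lemma integrable_monomial_mul_exp (p q : ι → ℕ) {w : ι → ℝ} (hw : ∀ m, 0 < w m) :
    Integrable (fun x => monomial p q x * ((Real.exp (-weightedNormSq w x) : ℝ) : ℂ))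
      (prodVolume ι) := by
  rw [prodVolume, measurableEmbedding_toLp.integrable_map_iff]
  simp only [Function.comp_def, monomial_mul_exp_weightedNormSq]
  exact Integrable.fintype_prod fun m => integrable_gaussMonomial (p m) (q m) (hw m)

lemma integral_monomial_mul_exp (p q : ι → ℕ) {w : ι → ℝ} (hw : ∀ m, 0 < w m) :
    ∫ x, monomial p q x * ((Real.exp (-weightedNormSq w x) : ℝ) : ℂ) ∂prodVolume ι
      = ((Real.pi ^ Fintype.card ι * ∏ m,
        if p m = q m then (p m).factorial / w m ^ (p m + 1) else 0 : ℝ) : ℂ) := by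
  rw [prodVolume, measurableEmbedding_toLp.integral_map]
  simp only [monomial_mul_exp_weightedNormSq]
  refine (integral_fintype_prod_volume_eq_prod fun m => gaussMonomial (p m) (q m) (w m)).trans ?_
  rw [← Finset.card_univ, ← Finset.prod_const, ← Finset.prod_mul_distrib, Complex.ofReal_prod]
  exact Finset.prod_congr rfl fun m _ => integral_gaussMonomial (p m) (q m) (hw m)

lemma integral_radial_monomial_mul_exp [Nonempty ι] {p q : ι → ℕ} {k : ℕ} {w : ι → ℝ}
    (hk : ∑ m, (p m + q m) = 2 * k) {x : EuclideanSpace ℂ ι} (hx : 0 < weightedNormSq w x) :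
    ∫ t in Set.Ioi (0 : ℝ), t ^ (2 * Fintype.card ι - 1) •
        (monomial p q (t • x) * ((Real.exp (-weightedNormSq w (t • x)) : ℝ) : ℂ))
      = (((Fintype.card ι + k - 1).factorial / 2 : ℝ) : ℂ) *
        (monomial p q x * (((weightedNormSq w x ^ (Fintype.card ι + k))⁻¹ : ℝ) : ℂ)) := by
  have hcard : 0 < Fintype.card ι := Fintype.card_pos
  have hradial (t : ℝ) : t ^ (2 * Fintype.card ι - 1) •
        (monomial p q (t • x) * ((Real.exp (-weightedNormSq w (t • x)) : ℝ) : ℂ))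
      = monomial p q x * ((t ^ (2 * (Fintype.card ι + k - 1) + 1)
        * Real.exp (-weightedNormSq w x * t ^ 2) : ℝ) : ℂ) := by
    rw [monomial_smul, weightedNormSq_smul, hk, Complex.real_smul, neg_mul,
      show 2 * (Fintype.card ι + k - 1) + 1 = (2 * Fintype.card ι - 1) + 2 * k by omega, pow_add]
    push_cast
    ring
  simp_rw [hradial]
  rw [integral_const_mul, integral_complex_ofReal, integral_pow_mul_exp_neg_mul_sq _ hx,
    show Fintype.card ι + k - 1 + 1 = Fintype.card ι + k by omega]
  push_cast
  field_simp

lemma integral_toSphere_monomial [Nonempty ι] {p q : ι → ℕ} {k : ℕ} {w : ι → ℝ}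
    (hw : ∀ m, 0 < w m) (hk : ∑ m, (p m + q m) = 2 * k) :
    ∫ ω : Metric.sphere (0 : EuclideanSpace ℂ ι) 1, monomial p q ω.1 *
        (((weightedNormSq w ω.1 ^ (Fintype.card ι + k))⁻¹ : ℝ) : ℂ) ∂(prodVolume ι).toSphere
      = ((2 * Real.pi ^ Fintype.card ι / (Fintype.card ι + k - 1).factorial * ∏ m,
        if p m = q m then (p m).factorial / w m ^ (p m + 1) else 0 : ℝ) : ℂ) := by
  have hdim : Module.finrank ℝ (EuclideanSpace ℂ ι) = 2 * Fintype.card ι := by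
    rw [← Module.finrank_mul_finrank ℝ ℂ, finrank_euclideanSpace, Complex.finrank_real_complex]
  have h := integral_eq_integral_toSphere _ (integrable_monomial_mul_exp p q hw)
  simp_rw [hdim, fun ω : Metric.sphere (0 : EuclideanSpace ℂ ι) 1 =>
    integral_radial_monomial_mul_exp hk (weightedNormSq_sphere_pos hw ω)] at h
  rw [integral_const_mul, integral_monomial_mul_exp p q hw] at h
  have hfact : ((Fintype.card ι + k - 1).factorial : ℂ) ≠ 0 :=
    Nat.cast_ne_zero.2 (Nat.factorial_ne_zero _)
  push_cast at h ⊢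
  field_simp at h ⊢
  linear_combination -h

end HaarMoments

variable {d : ℕ}

lemma haarPure_eq_smul_toSphere (μ : Measure (EuclideanSpace ℂ (Fin d))) [μ.IsAddHaarMeasure] :
    haarPure d = (μ.toSphere Set.univ)⁻¹ • μ.toSphere := by
  obtain ⟨c, hc⟩ : ∃ c : NNReal, (volume : Measure (EuclideanSpace ℂ (Fin d))) = c • μ :=
    ⟨_, Measure.isAddLeftInvariant_eq_smul _ _⟩
  have hc0 : (c : ENNReal) ≠ 0 := by
    rintro h
    rw [ENNReal.coe_eq_zero] at h
    exact NeZero.ne (volume : Measure (EuclideanSpace ℂ (Fin d))) (by rw [hc, h, zero_smul])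
  rw [haarPure, hc, ← Measure.coe_nnreal_smul, toSphere_smul, Measure.smul_apply, smul_eq_mul,
    ENNReal.mul_inv (.inl hc0) (.inl ENNReal.coe_ne_top), smul_smul, mul_right_comm,
    ENNReal.inv_mul_cancel hc0 ENNReal.coe_ne_top, one_mul]

lemma isProbabilityMeasure_haarPure (hd : 0 < d) : IsProbabilityMeasure (haarPure d) := by
  have : Nonempty (Fin d) := ⟨⟨0, hd⟩⟩
  have : NeZero (volume : Measure (EuclideanSpace ℂ (Fin d))).toSphere :=
    ⟨Measure.toSphere_ne_zero _⟩
  exact isProbabilityMeasureSMul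

theorem integral_haarPure_monomial (hd : 0 < d) {p q : Fin d → ℕ} {k : ℕ} {w : Fin d → ℝ}
    (hw : ∀ m, 0 < w m) (hk : ∑ m, (p m + q m) = 2 * k) :
    ∫ ω : PureState d, monomial p q ω.1 *
        (((weightedNormSq w ω.1 ^ (d + k))⁻¹ : ℝ) : ℂ) ∂haarPure d
      = (((d - 1).factorial / (d + k - 1).factorial * ∏ m,
        if p m = q m then (p m).factorial / w m ^ (p m + 1) else 0 : ℝ) : ℂ) := by
  have : Nonempty (Fin d) := ⟨⟨0, hd⟩⟩
  have hmass : (prodVolume (Fin d)).toSphere.real Set.univ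
      = 2 * Real.pi ^ d / (d - 1).factorial := by
    have h := integral_toSphere_monomial (ι := Fin d) (p := 0) (q := 0) (k := 0) (w := 1)
      (fun _ => one_pos) (by simp)
    simp only [monomial, weightedNormSq_one_sphere, Pi.zero_apply, pow_zero, mul_one, one_pow,
      inv_one, Complex.ofReal_one, Finset.prod_const_one, integral_const, add_zero, if_true,
      Nat.factorial_zero, Nat.cast_one, Pi.one_apply, div_one, Complex.real_smul,
      Fintype.card_fin] at h
    exact_mod_cast h
  have h := integral_toSphere_monomial hw hk
  rw [Fintype.card_fin] at h
  rw [haarPure_eq_smul_toSphere (prodVolume (Fin d)), integral_smul_measure, h, ENNReal.toReal_inv,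
    ← Measure.real, hmass, Complex.real_smul, ← Complex.ofReal_mul]
  congr 1
  field_simp

/-! ### Half-line and trigonometric integrals -/

lemma hasDerivAt_inv_linear_pow {l : ℝ} (hl : l ≠ 0) (k : ℕ) {z : ℝ} (hz : 1 + z * l ≠ 0) :
    HasDerivAt (fun z : ℝ => -(((k : ℝ) + 1) * l)⁻¹ * ((1 + z * l) ^ (k + 1))⁻¹)
      (((1 + z * l) ^ (k + 2))⁻¹) z := by
  have hlin : HasDerivAt (fun z : ℝ => 1 + z * l) l z := by
    simpa using ((hasDerivAt_id z).mul_const l).const_add 1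
  refine (((hlin.fun_pow (k + 1)).fun_inv (pow_ne_zero _ hz)).const_mul
    (-(((k : ℝ) + 1) * l)⁻¹)).congr_deriv ?_
  have hk : (k : ℝ) + 1 ≠ 0 := by positivity
  rw [Nat.add_sub_cancel]
  push_cast
  generalize 1 + z * l = D at hz
  field_simp
  ring

section InvLinearPow

variable {l : ℝ} (hl : 0 < l) (k : ℕ)
include hl

lemma tendsto_inv_linear_pow : Tendsto (fun z : ℝ => ((1 + z * l) ^ (k + 1))⁻¹) atTop (𝓝 0) :=
  tendsto_inv_atTop_zero.comp <| (tendsto_pow_atTop k.succ_ne_zero).comp <|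
    tendsto_atTop_add_const_left _ _ (tendsto_id.atTop_mul_const hl)

lemma integrableOn_inv_linear_pow :
    IntegrableOn (fun z : ℝ => ((1 + z * l) ^ (k + 2))⁻¹) (Set.Ioi 0) := by
  refine integrableOn_Ioi_deriv_of_nonneg' (l := 0)
    (fun z (hz : 0 ≤ z) => hasDerivAt_inv_linear_pow hl.ne' k (by positivity))
    (fun z (hz : 0 < z) => by positivity) ?_
  simpa using (tendsto_inv_linear_pow hl k).const_mul (-(((k : ℝ) + 1) * l)⁻¹)

lemma integral_inv_linear_pow :
    ∫ z in Set.Ioi (0 : ℝ), ((1 + z * l) ^ (k + 2))⁻¹ = (((k : ℝ) + 1) * l)⁻¹ := by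
  rw [integral_Ioi_of_hasDerivAt_of_nonneg' (l := 0)
    (fun z (hz : 0 ≤ z) => hasDerivAt_inv_linear_pow hl.ne' k (by positivity))
    (fun z (hz : 0 < z) => by positivity)]
  · simp
  · simpa using (tendsto_inv_linear_pow hl k).const_mul (-(((k : ℝ) + 1) * l)⁻¹)

variable {Ω F : Type*} [MeasurableSpace Ω] {μ : Measure Ω}
  [NormedAddCommGroup F] [NormedSpace ℝ F] {p : Ω → ℝ} (hp : Measurable p)
  (hlp : ∀ᵐ ω ∂μ, l ≤ p ω) {M : Ω → F} (hM : Integrable M μ)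
include hp hlp hM

lemma integrable_prod_inv_linear_pow_smul :
    Integrable (fun y : ℝ × Ω => ((1 + y.1 * p y.2) ^ (k + 2))⁻¹ • M y.2)
      ((volume.restrict (Set.Ioi (0 : ℝ))).prod μ) := by
  have hmeas : Measurable fun y : ℝ × Ω => ((1 + y.1 * p y.2) ^ (k + 2))⁻¹ := by fun_prop
  refine ((integrableOn_inv_linear_pow hl k).mul_prod hM.norm).mono'
    (hmeas.aestronglyMeasurable.smul hM.aestronglyMeasurable.comp_snd) ?_
  filter_upwards [Measure.quasiMeasurePreserving_fst.ae (ae_restrict_mem measurableSet_Ioi),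
    Measure.quasiMeasurePreserving_snd.ae hlp] with y (hy : 0 < y.1) hly
  have hle : 1 + y.1 * l ≤ 1 + y.1 * p y.2 := by gcongr
  have hpos : 0 < 1 + y.1 * l := by positivity
  have hpos' := hpos.trans_le hle
  rw [norm_smul, Real.norm_eq_abs, abs_of_pos (by positivity)]
  gcongr

lemma integral_inv_smul_eq_integral_integral [SFinite μ] [CompleteSpace F] :
    ∫ ω, (p ω)⁻¹ • M ω ∂μ
      = ((k : ℝ) + 1) • ∫ z in Set.Ioi (0 : ℝ), ∫ ω, ((1 + z * p ω) ^ (k + 2))⁻¹ • M ω ∂μ := by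
  rw [integral_integral_swap (integrable_prod_inv_linear_pow_smul hl k hp hlp hM),
    ← integral_smul]
  refine integral_congr_ae ?_
  filter_upwards [hlp] with ω hω
  rw [integral_smul_const, integral_inv_linear_pow (hl.trans_le hω), mul_inv, smul_smul,
    mul_inv_cancel_left₀ (by positivity)]

end InvLinearPow

lemma integral_pow_mul_one_sub_pow (m n : ℕ) :
    ∫ x in (0 : ℝ)..1, x ^ m * (1 - x) ^ n
      = m.factorial * n.factorial / (m + n + 1).factorial := by
  have h := Complex.betaIntegral_eq_Gamma_mul_div ((m : ℂ) + 1) ((n : ℂ) + 1)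
    (by simp only [Complex.add_re, Complex.natCast_re, Complex.one_re]; positivity)
    (by simp only [Complex.add_re, Complex.natCast_re, Complex.one_re]; positivity)
  rw [Complex.betaIntegral, Complex.Gamma_nat_eq_factorial, Complex.Gamma_nat_eq_factorial,
    show (m : ℂ) + 1 + (n + 1) = ((m + n + 1 : ℕ) : ℂ) + 1 by push_cast; ring,
    Complex.Gamma_nat_eq_factorial] at h
  simp only [add_sub_cancel_right, Complex.cpow_natCast] at h
  apply Complex.ofReal_injective
  rw [← intervalIntegral.integral_ofReal]
  push_cast
  exact h

section Feynman

variable {A C : ℝ} (hA : 0 < A) (hC : 0 < C)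
include hA hC

lemma convexCombination_pos {x : ℝ} (hx : x ∈ Set.Icc (0 : ℝ) 1) : 0 < x * A + (1 - x) * C :=
  (lt_min hA hC).trans_le <| by
    nlinarith [mul_le_mul_of_nonneg_left (min_le_left A C) hx.1,
      mul_le_mul_of_nonneg_left (min_le_right A C) (sub_nonneg.2 hx.2)]

lemma hasDerivAt_feynman_substitution {x : ℝ} (hx : x ∈ Set.Icc (0 : ℝ) 1) :
    HasDerivAt (fun x => x * A / (x * A + (1 - x) * C))
      (A * C * ((x * A + (1 - x) * C) ^ 2)⁻¹) x := by
  have hnum : HasDerivAt (fun x : ℝ => x * A) A x := by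
    simpa using (hasDerivAt_id x).mul_const A
  have hden : HasDerivAt (fun x : ℝ => x * A + (1 - x) * C) (A + -C) x :=
    hnum.add (by simpa using ((hasDerivAt_id x).const_sub 1).mul_const C)
  refine (hnum.fun_div hden (convexCombination_pos hA hC hx).ne').congr_deriv ?_
  rw [div_eq_mul_inv]
  ring

lemma integral_feynman (m n : ℕ) :
    ∫ x in (0 : ℝ)..1, x ^ m * (1 - x) ^ n * ((x * A + (1 - x) * C) ^ (m + n + 2))⁻¹
      = m.factorial * n.factorial / (m + n + 1).factorial * (A ^ (m + 1) * C ^ (n + 1))⁻¹ := by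
  have hpos {x : ℝ} (hx : x ∈ Set.uIcc (0 : ℝ) 1) : 0 < x * A + (1 - x) * C :=
    convexCombination_pos hA hC (Set.uIcc_of_le (zero_le_one' ℝ) ▸ hx)
  have h := intervalIntegral.integral_comp_mul_deriv
    (fun x hx => hasDerivAt_feynman_substitution hA hC (x := x)
      (Set.uIcc_of_le (zero_le_one' ℝ) ▸ hx))
    (continuousOn_const.mul (ContinuousOn.inv₀ (by fun_prop)
      fun x hx => (pow_pos (hpos hx) 2).ne'))
    (g := fun y : ℝ => y ^ m * (1 - y) ^ n) (by fun_prop)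
  simp only [zero_mul, zero_div, one_mul, sub_self, add_zero, div_self hA.ne',
    integral_pow_mul_one_sub_pow] at h
  rw [← h, mul_comm, ← intervalIntegral.integral_const_mul]
  refine intervalIntegral.integral_congr fun x hx => ?_
  have hD := (hpos hx).ne'
  have hsub : 1 - x * A / (x * A + (1 - x) * C) = (1 - x) * C / (x * A + (1 - x) * C) := by
    field_simp
    ring
  simp only [Function.comp]
  rw [hsub, div_pow, div_pow, mul_pow, mul_pow]
  generalize x * A + (1 - x) * C = D at hD
  field_simp
  ring

end Feynman

/-- The integral `∫ (1 + l₁ z) ^ (-m) (1 + l₂ z) ^ (-n) dz` over the half line `z > 0`; the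
parameters `g_{jk}` are of this form. -/
def halfLineIntegral (l₁ l₂ : ℝ) (m n : ℕ) : ℝ :=
  ∫ z in Set.Ioi (0 : ℝ), ((1 + z * l₁) ^ m * (1 + z * l₂) ^ n)⁻¹

section HalfLine

variable {l₁ l₂ : ℝ} (h₁ : 0 < l₁) (h₂ : 0 < l₂)
include h₁ h₂

lemma inv_mul_pow_eq_integral_feynman (m n : ℕ) {z : ℝ} (hz : 0 < z) :
    ((1 + z * l₁) ^ (m + 1) * (1 + z * l₂) ^ (n + 1))⁻¹
      = (m + n + 1).factorial / (m.factorial * n.factorial) *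
        ∫ x in (0 : ℝ)..1, ((1 + z * (x * l₁ + (1 - x) * l₂)) ^ (m + n + 2))⁻¹ •
          (x ^ m * (1 - x) ^ n) := by
  have hcomb (x : ℝ) :
      ((1 + z * (x * l₁ + (1 - x) * l₂)) ^ (m + n + 2))⁻¹ • (x ^ m * (1 - x) ^ n)
        = x ^ m * (1 - x) ^ n
          * ((x * (1 + z * l₁) + (1 - x) * (1 + z * l₂)) ^ (m + n + 2))⁻¹ := by
    rw [smul_eq_mul, mul_comm]
    congr 3
    ring
  simp_rw [hcomb]
  rw [integral_feynman (by positivity) (by positivity) m n]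
  have := m.factorial_ne_zero
  have := n.factorial_ne_zero
  have := (m + n + 1).factorial_ne_zero
  field_simp

lemma halfLineIntegral_eq_intervalIntegral (m n : ℕ) :
    halfLineIntegral l₁ l₂ (m + 1) (n + 1) = (m + n).factorial / (m.factorial * n.factorial) *
      ∫ x in (0 : ℝ)..1, (x * l₁ + (1 - x) * l₂)⁻¹ * (x ^ m * (1 - x) ^ n) := by
  have hle : ∀ᵐ x ∂volume.restrict (Set.Ioc (0 : ℝ) 1), min l₁ l₂ ≤ x * l₁ + (1 - x) * l₂ := by
    filter_upwards [ae_restrict_mem measurableSet_Ioc] with x hx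
    nlinarith [mul_le_mul_of_nonneg_left (min_le_left l₁ l₂) hx.1.le,
      mul_le_mul_of_nonneg_left (min_le_right l₁ l₂) (sub_nonneg.2 hx.2)]
  have h := integral_inv_smul_eq_integral_integral (lt_min h₁ h₂) (m + n) (by fun_prop) hle
    (M := fun x => x ^ m * (1 - x) ^ n) (Continuous.intervalIntegrable (by fun_prop) 0 1).1
  rw [halfLineIntegral, setIntegral_congr_fun measurableSet_Ioi
    fun z hz => inv_mul_pow_eq_integral_feynman h₁ h₂ m n hz, integral_const_mul]
  simp only [intervalIntegral.integral_of_le zero_le_one, ← smul_eq_mul (_⁻¹)] at h ⊢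
  rw [h, Nat.factorial_succ, smul_eq_mul]
  push_cast
  ring

lemma integral_cos_sin_div_eq_intervalIntegral (m n : ℕ) :
    ∫ α in (0 : ℝ)..(Real.pi / 2), Real.cos α ^ (2 * m + 1) * Real.sin α ^ (2 * n + 1) /
        (Real.cos α ^ 2 * l₁ + Real.sin α ^ 2 * l₂)
      = 1 / 2 * ∫ x in (0 : ℝ)..1, (x * l₁ + (1 - x) * l₂)⁻¹ * (x ^ m * (1 - x) ^ n) := by
  have hderiv (α : ℝ) :
      HasDerivAt (fun α => Real.cos α ^ 2) (2 * Real.cos α * -Real.sin α) α := by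
    simpa using (Real.hasDerivAt_cos α).fun_pow 2
  have hpos (α : ℝ) : 0 < Real.cos α ^ 2 * l₁ + (1 - Real.cos α ^ 2) * l₂ :=
    convexCombination_pos h₁ h₂ ⟨sq_nonneg _, Real.cos_sq_le_one α⟩
  have h := intervalIntegral.integral_comp_mul_deriv' (a := 0) (b := Real.pi / 2)
    (g := fun x : ℝ => (x * l₁ + (1 - x) * l₂)⁻¹ * (x ^ m * (1 - x) ^ n))
    (fun α _ => hderiv α) (by fun_prop) (.mul (.inv₀ (by fun_prop) (by
      rintro _ ⟨α, _, rfl⟩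
      exact (hpos α).ne')) (by fun_prop))
  simp only [Real.cos_zero, Real.cos_pi_div_two, one_pow, ne_eq, OfNat.ofNat_ne_zero,
    not_false_eq_true, zero_pow] at h
  rw [intervalIntegral.integral_symm 0 1, ← neg_eq_iff_eq_neg, ← intervalIntegral.integral_neg] at h
  rw [← h, ← intervalIntegral.integral_const_mul]
  refine intervalIntegral.integral_congr fun α _ => ?_
  simp only [Function.comp, ← Real.sin_sq]
  rw [← pow_mul, ← pow_mul, div_eq_mul_inv]
  ring

lemma integrableOn_inv_mul_pow {m n : ℕ} (hmn : 2 ≤ m + n) :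
    IntegrableOn (fun z : ℝ => ((1 + z * l₁) ^ m * (1 + z * l₂) ^ n)⁻¹) (Set.Ioi 0) := by
  obtain ⟨k, hk⟩ := Nat.exists_eq_add_of_le' hmn
  have hl := lt_min h₁ h₂
  refine (integrableOn_inv_linear_pow hl k).mono' (by fun_prop) ?_
  filter_upwards [ae_restrict_mem measurableSet_Ioi] with z (hz : 0 < z)
  rw [Real.norm_eq_abs, abs_of_pos (by positivity), ← hk, pow_add]
  have := min_le_left l₁ l₂
  have := min_le_right l₁ l₂
  gcongr

lemma halfLineIntegral_pos {m n : ℕ} (hmn : 2 ≤ m + n) : 0 < halfLineIntegral l₁ l₂ m n := by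
  obtain ⟨k, hk⟩ := Nat.exists_eq_add_of_le' hmn
  have hl : 0 < max l₁ l₂ := lt_max_of_lt_left h₁
  calc 0 < (((k : ℝ) + 1) * max l₁ l₂)⁻¹ := by positivity
    _ = ∫ z in Set.Ioi (0 : ℝ), ((1 + z * max l₁ l₂) ^ (k + 2))⁻¹ :=
      (integral_inv_linear_pow hl k).symm
    _ ≤ halfLineIntegral l₁ l₂ m n := by
      refine setIntegral_mono_on (integrableOn_inv_linear_pow hl k)
        (integrableOn_inv_mul_pow h₁ h₂ hmn) measurableSet_Ioi fun z (hz : 0 < z) => ?_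
      rw [← hk, pow_add]
      have := le_max_left l₁ l₂
      have := le_max_right l₁ l₂
      gcongr

lemma two_mul_halfLineIntegral_le (m n : ℕ) :
    2 * halfLineIntegral l₁ l₂ (m + 1) (n + 1)
      ≤ halfLineIntegral l₁ l₂ (m + 2) n + halfLineIntegral l₁ l₂ m (n + 2) := by
  have hint {i j : ℕ} (hij : i + j = m + n + 2) :
      IntegrableOn (fun z : ℝ => ((1 + z * l₁) ^ i * (1 + z * l₂) ^ j)⁻¹) (Set.Ioi 0) :=
    integrableOn_inv_mul_pow h₁ h₂ (by omega)
  simp only [halfLineIntegral]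
  rw [← integral_const_mul, ← integral_add (hint (by ring)) (hint (by ring))]
  refine setIntegral_mono_on ((hint (by ring)).const_mul 2)
    ((hint (by ring)).add (hint (by ring))) measurableSet_Ioi fun z (hz : 0 < z) => ?_
  have : 0 < 1 + z * l₁ := by positivity
  have : 0 < 1 + z * l₂ := by positivity
  have hsq : ((1 + z * l₁) ^ (m + 2) * (1 + z * l₂) ^ n)⁻¹
        + ((1 + z * l₁) ^ m * (1 + z * l₂) ^ (n + 2))⁻¹
        - 2 * ((1 + z * l₁) ^ (m + 1) * (1 + z * l₂) ^ (n + 1))⁻¹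
      = ((1 + z * l₁) ^ m * (1 + z * l₂) ^ n)⁻¹ * ((1 + z * l₁)⁻¹ - (1 + z * l₂)⁻¹) ^ 2 := by
    field_simp
    ring
  exact sub_nonneg.1 (hsq.symm ▸ by positivity)

end HalfLine

lemma tendsto_halfLineIntegral {α : Type*} {F : Filter α} [F.IsCountablyGenerated] {l : ℝ}
    (hl : 0 < l) {f₁ f₂ : α → ℝ} (h₁ : Tendsto f₁ F (𝓝 l)) (h₂ : Tendsto f₂ F (𝓝 0))
    (h₂_nonneg : ∀ᶠ s in F, 0 ≤ f₂ s) (k n : ℕ) :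
    Tendsto (fun s => halfLineIntegral (f₁ s) (f₂ s) (k + 2) n) F
      (𝓝 ((((k : ℝ) + 1) * l)⁻¹)) := by
  rw [← integral_inv_linear_pow hl k]
  refine tendsto_integral_filter_of_dominated_convergence
    (fun z => ((1 + z * (l / 2)) ^ (k + 2))⁻¹) (Eventually.of_forall fun s => by fun_prop) ?_
    (integrableOn_inv_linear_pow (half_pos hl) k)
    ((ae_restrict_mem measurableSet_Ioi).mono fun z (hz : 0 < z) => ?_)
  · filter_upwards [h₁.eventually_const_le (half_lt_self hl), h₂_nonneg] with s hs₁ hs₂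
    filter_upwards [ae_restrict_mem measurableSet_Ioi] with z (hz : 0 < z)
    have hpos : 0 < f₁ s := (half_pos hl).trans_le hs₁
    have hone : 1 ≤ (1 + z * f₂ s) ^ n := one_le_pow₀ (by nlinarith)
    rw [Real.norm_eq_abs, abs_of_nonneg (by positivity)]
    refine inv_anti₀ (by positivity) ?_
    calc (1 + z * (l / 2)) ^ (k + 2) ≤ (1 + z * f₁ s) ^ (k + 2) := by gcongr
      _ ≤ _ := le_mul_of_one_le_right (by positivity) hone
  · have hlim : Tendsto (fun s => ((1 + z * f₁ s) ^ (k + 2) * (1 + z * f₂ s) ^ n)⁻¹) F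
        (𝓝 (((1 + z * l) ^ (k + 2) * (1 + z * 0) ^ n)⁻¹)) :=
      ((((h₁.const_mul z).const_add 1).pow _).mul (((h₂.const_mul z).const_add 1).pow _)).inv₀
        (by positivity)
    simpa using hlim

lemma integral_cos_mul_sin_pow (m : ℕ) :
    ∫ α in (0 : ℝ)..(Real.pi / 2), Real.cos α * Real.sin α ^ (2 * m + 1)
      = 1 / (2 * ((m : ℝ) + 1)) := by
  have hderiv (α : ℝ) : HasDerivAt (fun α => Real.sin α ^ (2 * m + 2) / (2 * ((m : ℝ) + 1)))
      (Real.cos α * Real.sin α ^ (2 * m + 1)) α := by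
    refine (((Real.hasDerivAt_sin α).fun_pow (2 * m + 2)).div_const _).congr_deriv ?_
    rw [show 2 * m + 2 - 1 = 2 * m + 1 by omega]
    push_cast
    field_simp
  rw [intervalIntegral.integral_eq_sub_of_hasDerivAt (fun α _ => hderiv α)
    (Continuous.intervalIntegrable (by fun_prop) _ _)]
  simp

section CosSinIntegral

variable {u : ℝ} (hu : 0 < u)
include hu

lemma continuous_cos_mul_sin_pow_div (m : ℕ) : Continuous fun α : ℝ =>
    Real.cos α * Real.sin α ^ (2 * m + 1) / (Real.cos α ^ 2 + u) :=
  Continuous.div (by fun_prop) (by fun_prop) fun α => by positivity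

lemma integral_cos_mul_sin_div :
    ∫ α in (0 : ℝ)..(Real.pi / 2), Real.cos α * Real.sin α / (Real.cos α ^ 2 + u)
      = 1 / 2 * Real.log ((1 + u) / u) := by
  have hderiv (α : ℝ) : HasDerivAt (fun α => -(1 / 2) * Real.log (Real.cos α ^ 2 + u))
      (Real.cos α * Real.sin α / (Real.cos α ^ 2 + u)) α := by
    have hpos : Real.cos α ^ 2 + u ≠ 0 := by positivity
    refine (((((Real.hasDerivAt_cos α).fun_pow 2).add_const u).log hpos).const_mul _).congr_deriv ?_
    push_cast
    field_simp
  rw [intervalIntegral.integral_eq_sub_of_hasDerivAt (fun α _ => hderiv α)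
    ((by simpa using continuous_cos_mul_sin_pow_div hu 0 : Continuous _).intervalIntegrable _ _),
    Real.log_div (by positivity) hu.ne', Real.cos_pi_div_two, Real.cos_zero]
  ring_nf

lemma integral_cos_mul_sin_pow_div_succ (m : ℕ) :
    ∫ α in (0 : ℝ)..(Real.pi / 2),
        Real.cos α * Real.sin α ^ (2 * (m + 1) + 1) / (Real.cos α ^ 2 + u)
      = (1 + u) * (∫ α in (0 : ℝ)..(Real.pi / 2),
          Real.cos α * Real.sin α ^ (2 * m + 1) / (Real.cos α ^ 2 + u))
        - 1 / (2 * ((m : ℝ) + 1)) := by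
  rw [← integral_cos_mul_sin_pow, ← intervalIntegral.integral_const_mul,
    ← intervalIntegral.integral_sub
      ((continuous_cos_mul_sin_pow_div hu m).const_mul _ |>.intervalIntegrable _ _)
      (Continuous.intervalIntegrable (by fun_prop) _ _)]
  refine intervalIntegral.integral_congr fun α _ => ?_
  have hpos : Real.cos α ^ 2 + u ≠ 0 := by positivity
  rw [show 2 * (m + 1) + 1 = 2 * m + 1 + 2 by ring, pow_add, Real.sin_sq]
  field_simp
  ring

theorem integral_cos_mul_sin_pow_div (m : ℕ) :
    ∫ α in (0 : ℝ)..(Real.pi / 2),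
        Real.cos α * Real.sin α ^ (2 * m + 1) / (Real.cos α ^ 2 + u) =
      (1 / 2) * (1 + u) ^ m * Real.log ((1 + u) / u)
        - (1 / 2) * ∑ n ∈ Finset.range m, (1 + u) ^ n / ((m : ℝ) - n) := by
  induction m with
  | zero => simpa using integral_cos_mul_sin_div hu
  | succ m ih =>
    have hsum : ∑ n ∈ Finset.range m, (1 + u) ^ (n + 1) / (((m + 1 : ℕ) : ℝ) - ((n + 1 : ℕ) : ℝ))
        = (1 + u) * ∑ n ∈ Finset.range m, (1 + u) ^ n / ((m : ℝ) - n) := by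
      rw [Finset.mul_sum]
      refine Finset.sum_congr rfl fun n _ => ?_
      push_cast
      rw [add_sub_add_right_eq_sub]
      ring
    rw [integral_cos_mul_sin_pow_div_succ hu, ih, Finset.sum_range_succ', hsum]
    push_cast
    rw [pow_zero, sub_zero]
    field_simp
    ring

end CosSinIntegral

/-! ### Averaging matrices of a partition -/

section FiberMean

variable {n κ : Type*} [Fintype n] [DecidableEq κ]

/-- The size of the block `c` of the partition of the index type into the fibers of `σ`. -/
def fiberCard (σ : n → κ) (c : κ) : ℕ := (Finset.univ.filter fun i => σ i = c).card

lemma sum_comp_eq_sum_fiberCard {K : Type*} [Semiring K] [Fintype κ] (σ : n → κ) (f : κ → K) :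
    ∑ i, f (σ i) = ∑ c, fiberCard σ c * f c := by
  rw [← Finset.sum_fiberwise Finset.univ σ]
  refine Finset.sum_congr rfl fun c _ => ?_
  rw [Finset.sum_congr rfl fun i hi => congrArg f (Finset.mem_filter.1 hi).2, Finset.sum_const,
    nsmul_eq_mul, fiberCard]

variable {K : Type*} [Field K]

/-- The matrix averaging over the blocks of the partition into the fibers of `σ`. -/
def fiberMean (K : Type*) [Field K] (σ : n → κ) : Matrix n n K :=
  Matrix.of fun i j => if σ j = σ i then (fiberCard σ (σ i) : K)⁻¹ else 0

lemma fiberMean_apply (σ : n → κ) (i j : n) :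
    fiberMean K σ i j = if σ j = σ i then (fiberCard σ (σ i) : K)⁻¹ else 0 := rfl

lemma isSymm_fiberMean (σ : n → κ) : (fiberMean K σ).IsSymm := by
  ext i j
  simp only [Matrix.transpose_apply, fiberMean_apply, eq_comm]
  split_ifs with h <;> simp [h]

lemma diagonal_mul_fiberMean [DecidableEq n] (σ : n → κ) (x : κ → K) :
    Matrix.diagonal (x ∘ σ) * fiberMean K σ = fiberMean K σ * Matrix.diagonal (x ∘ σ) := by
  ext i j
  simp only [Matrix.diagonal_mul, Matrix.mul_diagonal, fiberMean_apply, Function.comp_apply]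
  split_ifs with h
  · rw [h, mul_comm]
  · simp

variable [CharZero K]

lemma fiberCard_ne_zero (σ : n → κ) (i : n) : (fiberCard σ (σ i) : K) ≠ 0 := by
  have : (Finset.univ.filter fun j => σ j = σ i).Nonempty := ⟨i, by simp⟩
  exact_mod_cast this.card_pos.ne'

lemma fiberMean_mul_fiberMean_comp {κ' : Type*} [DecidableEq κ'] (σ : n → κ) (f : κ → κ') :
    fiberMean K σ * fiberMean K (f ∘ σ) = fiberMean K (f ∘ σ) := by
  ext i j
  have hterm (k : n) : fiberMean K σ i k * fiberMean K (f ∘ σ) k j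
      = if σ k = σ i then (fiberCard σ (σ i) : K)⁻¹ * fiberMean K (f ∘ σ) i j else 0 := by
    rw [fiberMean_apply σ]
    split_ifs with h
    · simp only [fiberMean_apply, Function.comp_apply, h]
    · exact zero_mul _
  rw [Matrix.mul_apply, Finset.sum_congr rfl fun k _ => hterm k, ← Finset.sum_filter,
    Finset.sum_const, nsmul_eq_mul]
  exact mul_inv_cancel_left₀ (fiberCard_ne_zero σ i) _

lemma fiberMean_comp_mul_fiberMean {κ' : Type*} [DecidableEq κ'] (σ : n → κ) (f : κ → κ') :
    fiberMean K (f ∘ σ) * fiberMean K σ = fiberMean K (f ∘ σ) := by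
  have h := congrArg Matrix.transpose (fiberMean_mul_fiberMean_comp (K := K) σ f)
  rwa [Matrix.transpose_mul, (isSymm_fiberMean _).eq, (isSymm_fiberMean _).eq] at h

end FiberMean

section SpectralMatrix

variable {n κ K : Type*} [Fintype n] [DecidableEq n] [DecidableEq κ] [Field K]

/-- The matrix with eigenvalue `x c` on the vectors of zero sum supported in the block `c` of the
partition `σ`, `z` on the vectors of zero sum which are constant on the blocks, and `w` on the
constant vectors. -/
def spectralMatrix (σ : n → κ) (x : κ → K) (z w : K) : Matrix n n K :=
  Matrix.diagonal (x ∘ σ) * (1 - fiberMean K σ)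
    + z • (fiberMean K σ - fiberMean K (fun _ : n => ())) + w • fiberMean K (fun _ : n => ())

lemma spectralMatrix_add (σ : n → κ) (x x' : κ → K) (z z' w w' : K) :
    spectralMatrix σ (x + x') (z + z') (w + w')
      = spectralMatrix σ x z w + spectralMatrix σ x' z' w' := by
  have hdiag : Matrix.diagonal ((x + x') ∘ σ)
      = Matrix.diagonal (x ∘ σ) + Matrix.diagonal (x' ∘ σ) := (Matrix.diagonal_add _ _).symm
  rw [spectralMatrix, spectralMatrix, spectralMatrix, hdiag, add_mul, add_smul, add_smul]
  abel

lemma spectralMatrix_const (σ : n → κ) (t : K) :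
    spectralMatrix σ (fun _ => t) t t = Matrix.scalar n t := by
  rw [spectralMatrix, show (fun _ : κ => t) ∘ σ = fun _ => t from rfl,
    ← Matrix.smul_one_eq_diagonal, smul_mul_assoc, one_mul, ← smul_add, ← smul_add,
    sub_add_sub_cancel, sub_add_cancel, Matrix.scalar_apply, Matrix.smul_one_eq_diagonal]

lemma isSymm_spectralMatrix (σ : n → κ) (x : κ → K) (z w : K) :
    (spectralMatrix σ x z w).IsSymm := by
  rw [Matrix.IsSymm, spectralMatrix, mul_sub, mul_one]
  simp only [Matrix.transpose_add, Matrix.transpose_sub, Matrix.transpose_smul,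
    Matrix.transpose_mul, Matrix.diagonal_transpose, (isSymm_fiberMean _).eq,
    diagonal_mul_fiberMean]

lemma add_smul_add_smul_mul_of_isIdempotentElem {A : Type*} [Ring A] [Algebra K A]
    {P J D' : A} (hP : P * P = P) (hJ : J * J = J) (hPJ : P * J = J) (hJP : J * P = J)
    (hcomm : D' * P = P * D') (D : A) (z z' w w' : K) :
    (D * (1 - P) + z • (P - J) + w • J) * (D' * (1 - P) + z' • (P - J) + w' • J)
      = D * D' * (1 - P) + (z * z') • (P - J) + (w * w') • J := by
  have hQD : D' * (1 - P) = (1 - P) * D' := by rw [mul_sub, sub_mul, hcomm, mul_one, one_mul]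
  have hQQ : (1 - P) * (1 - P) = 1 - P := by simp [sub_mul, mul_sub, hP]
  have hQR : (1 - P) * (P - J) = 0 := by simp [sub_mul, mul_sub, hP, hPJ]
  have hRQ : (P - J) * (1 - P) = 0 := by simp [sub_mul, mul_sub, hP, hJP]
  have hRR : (P - J) * (P - J) = P - J := by simp [sub_mul, mul_sub, hP, hPJ, hJP, hJ]
  have hQJ : (1 - P) * J = 0 := by simp [sub_mul, hPJ]
  have hJQ : J * (1 - P) = 0 := by simp [mul_sub, hJP]
  have hRJ : (P - J) * J = 0 := by simp [sub_mul, hPJ, hJ]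
  have hJR : J * (P - J) = 0 := by simp [mul_sub, hJP, hJ]
  have hDQDQ : D * (1 - P) * (D' * (1 - P)) = D * D' * (1 - P) := by
    rw [mul_assoc, ← mul_assoc (1 - P), ← hQD, mul_assoc D', hQQ, mul_assoc]
  have hRDQ : (P - J) * (D' * (1 - P)) = 0 := by rw [hQD, ← mul_assoc, hRQ, zero_mul]
  have hJDQ : J * (D' * (1 - P)) = 0 := by rw [hQD, ← mul_assoc, hJQ, zero_mul]
  simp only [add_mul, mul_add, smul_mul_assoc, mul_smul_comm, hDQDQ, hRDQ, hJDQ, mul_assoc D, hQR,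
    hQJ, hRR, hRJ, hJR, hJ, smul_smul, smul_zero, mul_zero, add_zero, zero_add, mul_comm z',
    mul_comm w']

variable [CharZero K]

lemma spectralMatrix_mul (σ : n → κ) (x x' : κ → K) (z z' w w' : K) :
    spectralMatrix σ x z w * spectralMatrix σ x' z' w'
      = spectralMatrix σ (x * x') (z * z') (w * w') := by
  have hdiag : Matrix.diagonal ((x * x') ∘ σ)
      = Matrix.diagonal (x ∘ σ) * Matrix.diagonal (x' ∘ σ) :=
    (Matrix.diagonal_mul_diagonal _ _).symm
  rw [spectralMatrix, spectralMatrix, spectralMatrix, hdiag]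
  exact add_smul_add_smul_mul_of_isIdempotentElem (fiberMean_mul_fiberMean_comp σ id)
    (fiberMean_mul_fiberMean_comp _ id) (fiberMean_mul_fiberMean_comp σ fun _ => ())
    (fiberMean_comp_mul_fiberMean σ fun _ => ()) (diagonal_mul_fiberMean σ x') _ _ _ _ _

lemma spectralMatrix_mulVec_one (σ : n → κ) (x : κ → K) (z : K) :
    spectralMatrix σ x z 0 *ᵥ 1 = 0 := by
  have hJ : fiberMean K (fun _ : n => ()) *ᵥ 1 = 1 := by
    ext i
    have hcard : fiberCard (fun _ : n => ()) () = Fintype.card n := by simp [fiberCard]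
    simp only [Matrix.mulVec, dotProduct, Pi.one_apply, mul_one, fiberMean_apply, if_true,
      Finset.sum_const, Finset.card_univ, nsmul_eq_mul, ← hcard]
    exact mul_inv_cancel₀ (fiberCard_ne_zero (fun _ : n => ()) i)
  have hP : fiberMean K σ *ᵥ 1 = 1 := by
    rw [← hJ, Matrix.mulVec_mulVec, fiberMean_mul_fiberMean_comp σ fun _ => ()]
  simp [spectralMatrix, Matrix.add_mulVec, ← Matrix.mulVec_mulVec, Matrix.sub_mulVec, hP, hJ,
    Matrix.smul_mulVec]

lemma trace_diagonal_mul_spectralMatrix [Fintype κ] {σ : n → κ} (hσ : Function.Surjective σ)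
    (l x : κ → K) (z w : K) :
    (Matrix.diagonal (l ∘ σ) * spectralMatrix σ x z w).trace
      = ∑ c, l c * ((fiberCard σ c - 1) * x c + z
        + fiberCard σ c * (w - z) / Fintype.card n) := by
  have hterm (i : n) : (Matrix.diagonal (l ∘ σ) * spectralMatrix σ x z w) i i
      = l (σ i) * (x (σ i) * (1 - (fiberCard σ (σ i) : K)⁻¹)
        + z * ((fiberCard σ (σ i) : K)⁻¹ - (Fintype.card n : K)⁻¹)
        + w * (Fintype.card n : K)⁻¹) := by
    simp [spectralMatrix, Matrix.diagonal_mul, fiberMean_apply, fiberCard]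
  simp only [Matrix.trace, Matrix.diag_apply, hterm]
  rw [sum_comp_eq_sum_fiberCard σ fun c => l c * (x c * (1 - (fiberCard σ c : K)⁻¹)
        + z * ((fiberCard σ c : K)⁻¹ - (Fintype.card n : K)⁻¹) + w * (Fintype.card n : K)⁻¹)]
  refine Finset.sum_congr rfl fun c _ => ?_
  obtain ⟨i, rfl⟩ := hσ c
  have := fiberCard_ne_zero (K := K) σ i
  field_simp
  ring

end SpectralMatrix

section AlgHomPi

variable {K V : Type*} [Field K] [AddCommGroup V] [Module K V] [FiniteDimensional K V]

lemma det_smul_add_one_sub {P : Module.End K V} (hP : IsIdempotentElem P) (c : K) :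
    LinearMap.det (c • P + (1 - P)) = c ^ Module.finrank K (LinearMap.range P) := by
  have hmem (v : V) : (c • P + (1 - P)) v - v ∈ LinearMap.range P := by
    simpa [add_sub_right_comm, sub_eq_add_neg, add_assoc] using
      sub_mem (Submodule.smul_mem _ c (LinearMap.mem_range_self P v)) (LinearMap.mem_range_self P v)
  have hrange {v : V} (hv : v ∈ LinearMap.range P) : (c • P + (1 - P)) v = c • v := by
    simp [(LinearMap.IsIdempotentElem.mem_range_iff hP).1 hv]
  have hinv : LinearMap.range P ≤ (LinearMap.range P).comap (c • P + (1 - P)) := fun v hv => by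
    simpa only [Submodule.mem_comap, hrange hv] using Submodule.smul_mem _ c hv
  have hrestrict : (c • P + (1 - P)).restrict hinv
      = (c • LinearMap.id : Module.End K (LinearMap.range P)) :=
    LinearMap.ext fun v => Subtype.ext (hrange v.2)
  have hquot : (LinearMap.range P).mapQ (LinearMap.range P) (c • P + (1 - P)) hinv
      = LinearMap.id :=
    Submodule.linearMap_qext _ <| LinearMap.ext fun v => (Submodule.Quotient.eq _).2 (hmem v)
  rw [LinearMap.det_eq_det_mul_det _ _ hinv, hrestrict, hquot, LinearMap.det_smul,
    LinearMap.det_id, LinearMap.det_id, mul_one, mul_one]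

variable {ι : Type*} [Fintype ι] [DecidableEq ι] [CharZero K] {φ : (ι → K) →ₐ[K] Module.End K V}
  {m : ι → ℕ} (hφ : ∀ i, LinearMap.trace K V (φ (Pi.single i 1)) = m i)
include hφ

lemma det_algHom_pi (x : ι → K) : LinearMap.det (φ x) = ∏ i, x i ^ m i := by
  have hidem (i : ι) : IsIdempotentElem (φ (Pi.single i 1)) := by
    rw [IsIdempotentElem, ← map_mul, ← Pi.single_mul, mul_one]
  have hrank (i : ι) : Module.finrank K (LinearMap.range (φ (Pi.single i 1))) = m i := by
    have := hφ i
    rw [LinearMap.IsProj.trace (LinearMap.IsIdempotentElem.isProj_range _ (hidem i))] at this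
    exact_mod_cast this
  have hsingle (i : ι) (c : K) : φ (Pi.mulSingle i c)
      = c • φ (Pi.single i 1) + (1 - φ (Pi.single i 1)) := by
    rw [← map_one φ, ← map_smul, ← map_sub, ← map_add]
    congr 1
    ext j
    rcases eq_or_ne j i with rfl | h <;> simp [*]
  calc LinearMap.det (φ x) = (LinearMap.det.comp (φ : (ι → K) →* Module.End K V)) x := rfl
    _ = ∏ i, (LinearMap.det.comp (φ : (ι → K) →* Module.End K V)) (Pi.mulSingle i (x i)) := by
      rw [← map_prod, Finset.univ_prod_mulSingle]
    _ = ∏ i, LinearMap.det (x i • φ (Pi.single i 1) + (1 - φ (Pi.single i 1))) := by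
      simp_rw [← hsingle]
      rfl
    _ = ∏ i, x i ^ m i := by simp_rw [det_smul_add_one_sub (hidem _), hrank]

lemma charpoly_algHom_pi (x : ι → K) :
    (φ x).charpoly = ∏ i, (Polynomial.X - Polynomial.C (x i)) ^ m i := by
  refine Polynomial.funext fun t => ?_
  have : algebraMap K _ t - φ x = φ (fun i => t - x i) := by
    rw [← AlgHom.commutes φ, ← map_sub]
    rfl
  rw [LinearMap.eval_charpoly, this, det_algHom_pi hφ]
  simp [Polynomial.eval_prod]

end AlgHomPi

section CharpolySpectralMatrix

variable {n κ K : Type*} [Fintype n] [DecidableEq κ] [Field K]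

lemma fiberMean_unit_apply (i j : n) :
    fiberMean K (fun _ : n => ()) i j = (Fintype.card n : K)⁻¹ := by
  simp [fiberMean_apply, fiberCard]

variable [DecidableEq n]

lemma spectralMatrix_apply (σ : n → κ) (x : κ → K) (z w : K) (i j : n) :
    spectralMatrix σ x z w i j = (if i = j then x (σ i) else 0)
      + (if σ j = σ i then (fiberCard σ (σ i) : K)⁻¹ * (z - x (σ i)) else 0)
      + (w - z) * (Fintype.card n : K)⁻¹ := by
  simp only [spectralMatrix, Matrix.add_apply, Matrix.diagonal_mul, Matrix.sub_apply,
    Matrix.smul_apply, Matrix.one_apply, fiberMean_unit_apply, Function.comp_apply, smul_eq_mul]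
  rw [fiberMean_apply]
  split_ifs <;> ring

lemma spectralMatrix_one_one_zero (σ : n → κ) :
    spectralMatrix σ 1 1 (0 : K) = 1 - fiberMean K (fun _ : n => ()) := by
  have hone : Matrix.diagonal ((1 : κ → K) ∘ σ) = 1 := Matrix.diagonal_one
  rw [spectralMatrix, hone, one_mul, one_smul, zero_smul, add_zero, sub_add_sub_cancel]

variable [CharZero K]

/-- `spectralMatrix` as an algebra homomorphism from the diagonal algebra; the two extra
coordinates are the eigenvalues `z` and `w`. -/
def spectralMatrixAlgHom (K : Type*) [Field K] [CharZero K] (σ : n → κ) :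
    (κ ⊕ Fin 2 → K) →ₐ[K] Module.End K (n → K) :=
  (Matrix.toLinAlgEquiv' : Matrix n n K ≃ₐ[K] _).toAlgHom.comp <| AlgHom.mk
    { toFun := fun y => spectralMatrix σ (y ∘ Sum.inl) (y (Sum.inr 0)) (y (Sum.inr 1))
      map_one' := (spectralMatrix_const σ 1).trans (map_one _)
      map_mul' := fun _ _ => (spectralMatrix_mul σ _ _ _ _ _ _).symm
      map_zero' := (spectralMatrix_const σ 0).trans (map_zero _)
      map_add' := fun _ _ => spectralMatrix_add σ _ _ _ _ _ _ }
    (spectralMatrix_const σ)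

variable [Fintype κ]

lemma trace_spectralMatrix [Nonempty n] {σ : n → κ} (hσ : Function.Surjective σ) (x : κ → K)
    (z w : K) : (spectralMatrix σ x z w).trace
      = ∑ c, (fiberCard σ c - 1 : ℕ) * x c + (Fintype.card κ - 1 : ℕ) * z + w := by
  have hdiag : Matrix.diagonal ((1 : κ → K) ∘ σ) = 1 := Matrix.diagonal_one
  have hsum : ∑ c, (fiberCard σ c : K) = Fintype.card n := by
    simpa using (sum_comp_eq_sum_fiberCard σ fun _ => (1 : K)).symm
  have hn : (Fintype.card n : K) ≠ 0 := Nat.cast_ne_zero.2 Fintype.card_ne_zero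
  have : Nonempty κ := ‹Nonempty n›.map σ
  have hcast (c : κ) : ((fiberCard σ c - 1 : ℕ) : K) = fiberCard σ c - 1 := by
    obtain ⟨i, rfl⟩ := hσ c
    exact Nat.cast_pred (Nat.pos_of_ne_zero fun h => fiberCard_ne_zero (K := K) σ i (by simp [h]))
  rw [← one_mul (spectralMatrix σ x z w), ← hdiag, trace_diagonal_mul_spectralMatrix hσ,
    Nat.cast_pred Fintype.card_pos]
  simp only [Pi.one_apply, one_mul, Finset.sum_add_distrib, ← Finset.sum_div, ← Finset.sum_mul,
    hsum, hcast, Finset.sum_const, Finset.card_univ, nsmul_eq_mul]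
  field_simp
  ring

lemma charpoly_spectralMatrix [Nonempty n] {σ : n → κ} (hσ : Function.Surjective σ) (x : κ → K)
    (z w : K) : (spectralMatrix σ x z w).charpoly
      = (∏ c, (Polynomial.X - Polynomial.C (x c)) ^ (fiberCard σ c - 1))
        * (Polynomial.X - Polynomial.C z) ^ (Fintype.card κ - 1)
        * (Polynomial.X - Polynomial.C w) := by
  have htrace (i : κ ⊕ Fin 2) :
      LinearMap.trace K _ (spectralMatrixAlgHom K σ (Pi.single i 1))
        = (Sum.elim (fun c => fiberCard σ c - 1) ![Fintype.card κ - 1, 1] i : ℕ) := by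
    change LinearMap.trace K _ (Matrix.toLin' (spectralMatrix σ _ _ _)) = _
    rw [Matrix.trace_toLin'_eq, trace_spectralMatrix hσ]
    rcases i with c | i
    · simp [Pi.single_apply]
    · fin_cases i <;> simp
  have h := charpoly_algHom_pi htrace (Sum.elim x ![z, w])
  have happly : spectralMatrixAlgHom K σ (Sum.elim x ![z, w])
      = Matrix.toLin' (spectralMatrix σ x z w) := rfl
  simpa [happly, ← mul_assoc] using h

end CharpolySpectralMatrix

/-! ### Superoperators of Schur type -/

section SchurSuper

variable {d : ℕ}

lemma trace_superOp (T : SuperOp d) :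
    LinearMap.trace ℂ (Op d) T = ∑ i, ∑ j, T (E i j) i j := by
  rw [LinearMap.trace_eq_matrix_trace ℂ (Matrix.stdBasis ℂ (Fin d) (Fin d)), Matrix.trace,
    Fintype.sum_prod_type]
  refine Finset.sum_congr rfl fun i _ => Finset.sum_congr rfl fun j _ => ?_
  rw [Matrix.diag_apply, LinearMap.toMatrix_apply, Matrix.stdBasis_eq_single]
  rfl

/-- The superoperator acting on the diagonal by the matrix `N` and on the off-diagonal part by
entrywise (Schur) multiplication by `v`; the diagonal values of `v` play no role. All superoperators
attached to a diagonal state are of this form. -/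
def schurSuper (v : Fin d → Fin d → ℝ) (N : Matrix (Fin d) (Fin d) ℝ) : SuperOp d where
  toFun X := Matrix.of fun i j =>
    if i = j then ∑ k, ((N i k : ℝ) : ℂ) * X k k else ((v i j : ℝ) : ℂ) * X i j
  map_add' X Y := by
    ext i j
    simp only [Matrix.of_apply, Matrix.add_apply, mul_add, Finset.sum_add_distrib]
    split_ifs <;> rfl
  map_smul' c X := by
    ext i j
    simp only [Matrix.of_apply, Matrix.smul_apply, smul_eq_mul, RingHom.id_apply, mul_left_comm _ c,
      ← Finset.mul_sum]
    split_ifs <;> rfl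

variable (v v' : Fin d → Fin d → ℝ) (N N' : Matrix (Fin d) (Fin d) ℝ)

lemma schurSuper_apply_self (X : Op d) (i : Fin d) :
    schurSuper v N X i i = ∑ k, ((N i k : ℝ) : ℂ) * X k k :=
  if_pos rfl

variable {v v' N N'} in
lemma schurSuper_apply_of_ne (X : Op d) {i j : Fin d} (h : i ≠ j) :
    schurSuper v N X i j = ((v i j : ℝ) : ℂ) * X i j :=
  if_neg h

variable {v v' N N'} in
lemma schurSuper_congr (hv : ∀ i j, i ≠ j → v i j = v' i j) (hN : N = N') :
    schurSuper v N = schurSuper v' N' := by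
  subst hN
  refine LinearMap.ext fun X => ?_
  ext i j
  rcases eq_or_ne i j with rfl | h
  · simp only [schurSuper_apply_self]
  · rw [schurSuper_apply_of_ne X h, schurSuper_apply_of_ne X h, hv i j h]

lemma schurSuper_mul :
    schurSuper v N * schurSuper v' N' = schurSuper (fun i j => v i j * v' i j) (N * N') := by
  refine LinearMap.ext fun X => ?_
  ext i j
  rw [Module.End.mul_apply]
  rcases eq_or_ne i j with rfl | h
  · simp only [schurSuper_apply_self, Matrix.mul_apply, Finset.mul_sum, Complex.ofReal_sum,
      Complex.ofReal_mul, Finset.sum_mul, mul_assoc]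
    exact Finset.sum_comm
  · simp only [schurSuper_apply_of_ne _ h, Complex.ofReal_mul, mul_assoc]

lemma schurSuper_add :
    schurSuper (fun i j => v i j + v' i j) (N + N') = schurSuper v N + schurSuper v' N' := by
  refine LinearMap.ext fun X => ?_
  ext i j
  rw [LinearMap.add_apply, Matrix.add_apply]
  rcases eq_or_ne i j with rfl | h
  · simp only [schurSuper_apply_self, Matrix.add_apply, Complex.ofReal_add, add_mul,
      Finset.sum_add_distrib]
  · simp only [schurSuper_apply_of_ne _ h, Complex.ofReal_add, add_mul]

lemma schurSuper_scalar (t : ℝ) :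
    schurSuper (fun _ _ => t) (Matrix.scalar (Fin d) t) = algebraMap ℝ (SuperOp d) t := by
  refine LinearMap.ext fun X => ?_
  ext i j
  rw [Module.algebraMap_end_apply, Matrix.smul_apply, Complex.real_smul]
  rcases eq_or_ne i j with rfl | h
  · rw [schurSuper_apply_self, Finset.sum_eq_single i]
    · simp
    · intro k _ hk
      simp [hk.symm]
    · simp
  · exact schurSuper_apply_of_ne X h

variable {v} in
lemma schurSuper_E {j k : Fin d} (h : j ≠ k) :
    schurSuper v N (E j k) = ((v j k : ℝ) : ℂ) • E j k := by
  ext a b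
  rcases eq_or_ne a b with rfl | hab
  · have hzero (m : Fin d) : E j k m m = 0 := by
      rw [E, Matrix.single_apply, if_neg (by rintro ⟨rfl, rfl⟩; exact h rfl)]
    simp [schurSuper_apply_self, hzero]
  · rw [schurSuper_apply_of_ne _ hab, Matrix.smul_apply, smul_eq_mul, E, Matrix.single_apply]
    split_ifs with hjk
    · rw [hjk.1, hjk.2]
    · simp only [mul_zero]

variable {v} in
lemma schurSuper_Eplus {j k : Fin d} (h : j ≠ k) (hv : v k j = v j k) :
    schurSuper v N (Eplus j k) = ((v j k : ℝ) : ℂ) • Eplus j k := by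
  rw [Eplus, map_smul, map_add, schurSuper_E N h, schurSuper_E N h.symm, hv, ← smul_add, smul_comm]

variable {v} in
lemma schurSuper_Eminus {j k : Fin d} (h : j ≠ k) (hv : v k j = v j k) :
    schurSuper v N (Eminus j k) = ((v j k : ℝ) : ℂ) • Eminus j k := by
  rw [Eminus, map_smul, map_sub, schurSuper_E N h, schurSuper_E N h.symm, hv, ← smul_sub, smul_comm]

variable {N} in
lemma trace_conjTranspose_mul_schurSuper (hN : N.IsSymm) (X Y : Op d) :
    (Xᴴ * schurSuper v N Y).trace = ((schurSuper v N X)ᴴ * Y).trace := by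
  have hsplit (A B : Op d) : (Aᴴ * B).trace
      = (∑ i, star (A i i) * B i i) + ∑ i, ∑ j ∈ {i}ᶜ, star (A i j) * B i j := by
    simp only [Matrix.trace, Matrix.diag_apply, Matrix.mul_apply, Matrix.conjTranspose_apply]
    rw [Finset.sum_comm, ← Finset.sum_add_distrib]
    exact Finset.sum_congr rfl fun i _ => Fintype.sum_eq_add_sum_compl i _
  rw [hsplit, hsplit]
  congr 1
  · simp only [schurSuper_apply_self, star_sum, star_mul', Complex.star_def, Complex.conj_ofReal,
      Finset.mul_sum, Finset.sum_mul]
    rw [Finset.sum_comm]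
    refine Finset.sum_congr rfl fun i _ => Finset.sum_congr rfl fun k _ => ?_
    rw [← hN.apply k i]
    ring
  · refine Finset.sum_congr rfl fun i _ => Finset.sum_congr rfl fun j hj => ?_
    have hij : i ≠ j := by simpa [eq_comm] using hj
    simp only [schurSuper_apply_of_ne _ hij, star_mul', Complex.star_def, Complex.conj_ofReal]
    ring

lemma trace_schurSuper :
    LinearMap.trace ℂ (Op d) (schurSuper v N)
      = ((N.trace + (∑ i, ∑ j, v i j - ∑ i, v i i) : ℝ) : ℂ) := by
  have hentry (i j : Fin d) : schurSuper v N (E i j) i j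
      = ((v i j + if i = j then N i i - v i i else 0 : ℝ) : ℂ) := by
    rcases eq_or_ne i j with rfl | h
    · simp [schurSuper_apply_self, E, Matrix.single_apply]
    · simp [schurSuper_apply_of_ne _ h, E, h]
  simp only [trace_superOp, hentry, ← Complex.ofReal_sum, Finset.sum_add_distrib,
    Finset.sum_ite_eq, Finset.mem_univ, if_true, Finset.sum_sub_distrib, Matrix.trace,
    Matrix.diag_apply]
  congr 1
  ring

variable {N} in
lemma schurSuper_one_eq_zero (hN : N *ᵥ 1 = 0) : schurSuper v N 1 = 0 := by
  ext i j
  rcases eq_or_ne i j with rfl | h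
  · have hrow : ∑ k, N i k = 0 := by simpa [Matrix.mulVec, dotProduct] using congrFun hN i
    simp only [schurSuper_apply_self, Matrix.one_apply_eq, mul_one, Matrix.zero_apply,
      ← Complex.ofReal_sum, hrow, Complex.ofReal_zero]
  · simp [schurSuper_apply_of_ne _ h, h]

variable {v N} in
lemma schurSuper_mem_tracelessHerm (hv : ∀ i j, v i j = v j i) (hN : 1 ᵥ* N = 0) {X : Op d}
    (hX : X.IsHermitian) : schurSuper v N X ∈ tracelessHerm d := by
  have hstar (i j : Fin d) : star (X j i) = X i j := hX.apply i j
  constructor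
  · ext i j
    rw [Matrix.conjTranspose_apply]
    rcases eq_or_ne i j with rfl | h
    · simp only [schurSuper_apply_self, star_sum, star_mul', hstar, Complex.star_def,
        Complex.conj_ofReal]
    · rw [schurSuper_apply_of_ne _ h, schurSuper_apply_of_ne _ h.symm, star_mul', hstar, hv j i,
        Complex.star_def, Complex.conj_ofReal]
  · have hcol (k : Fin d) : ∑ i, N i k = 0 := by
      simpa [Matrix.vecMul, dotProduct] using congrFun hN k
    simp only [Matrix.trace, Matrix.diag_apply, schurSuper_apply_self]
    rw [Finset.sum_comm]
    refine Finset.sum_eq_zero fun k _ => ?_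
    rw [← Finset.sum_mul, ← Complex.ofReal_sum, hcol, Complex.ofReal_zero, zero_mul]

end SchurSuper

section PartitionSuper

variable {d : ℕ} {κ : Type*} [DecidableEq κ]

/-- The superoperator which multiplies the off-diagonal entries between the blocks `c` and `c'` of
the partition `σ` by `V c c'`, has eigenvalue `V c c` on the traceless diagonal operators supported
in the block `c`, `z` on the traceless diagonal operators which are constant on the blocks, and `w`
on the identity. -/
def partitionSuper (σ : Fin d → κ) (V : κ → κ → ℝ) (z w : ℝ) : SuperOp d :=
  schurSuper (fun i j => V (σ i) (σ j)) (spectralMatrix σ (fun c => V c c) z w)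

variable (σ : Fin d → κ) (V V' : κ → κ → ℝ) (z z' w w' : ℝ)

lemma partitionSuper_mul : partitionSuper σ V z w * partitionSuper σ V' z' w'
    = partitionSuper σ (V * V') (z * z') (w * w') := by
  rw [partitionSuper, partitionSuper, schurSuper_mul, spectralMatrix_mul]
  rfl

lemma partitionSuper_add : partitionSuper σ (V + V') (z + z') (w + w')
    = partitionSuper σ V z w + partitionSuper σ V' z' w' := by
  rw [partitionSuper, partitionSuper, partitionSuper, ← schurSuper_add, ← spectralMatrix_add]
  rfl

lemma partitionSuper_const (t : ℝ) :
    partitionSuper σ (fun _ _ => t) t t = algebraMap ℝ (SuperOp d) t := by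
  rw [partitionSuper, spectralMatrix_const, schurSuper_scalar]

lemma partitionSuper_one : partitionSuper σ V z 0 1 = 0 :=
  schurSuper_one_eq_zero _ (spectralMatrix_mulVec_one σ _ z)

variable {σ V z w} in
lemma partitionSuper_mem_tracelessHerm (hV : ∀ c c', V c c' = V c' c) {X : Op d}
    (hX : X.IsHermitian) : partitionSuper σ V z 0 X ∈ tracelessHerm d := by
  refine schurSuper_mem_tracelessHerm (fun i j => hV _ _) ?_ hX
  rw [← Matrix.mulVec_transpose, (isSymm_spectralMatrix σ _ _ _).eq, spectralMatrix_mulVec_one]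

variable {σ} in
lemma trace_schurSuper_diagonal_mul_partitionSuper [Fintype κ] (hσ : Function.Surjective σ)
    (U : κ → κ → ℝ) :
    LinearMap.trace ℂ (Op d) (schurSuper (fun i j => U (σ i) (σ j))
        (Matrix.diagonal ((fun c => U c c) ∘ σ)) * partitionSuper σ V z w)
      = ((∑ c, ∑ c', fiberCard σ c * fiberCard σ c' * (U c c' * V c c')
        + ∑ c, U c c * (z - V c c + fiberCard σ c * (w - z) / d) : ℝ) : ℂ) := by
  rw [partitionSuper, schurSuper_mul, trace_schurSuper, trace_diagonal_mul_spectralMatrix hσ,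
    sum_comp_eq_sum_fiberCard σ fun c => U c c * V c c,
    sum_comp_eq_sum_fiberCard σ fun c => ∑ j, U c (σ j) * V c (σ j)]
  simp_rw [fun c => sum_comp_eq_sum_fiberCard σ fun c' => U c c' * V c c', Finset.mul_sum,
    ← mul_assoc, Fintype.card_fin]
  rw [add_sub_left_comm, ← Finset.sum_sub_distrib]
  congr 2
  exact Finset.sum_congr rfl fun c _ => by ring

end PartitionSuper

section TracelessHermitian

lemma trace_restrictScalars (R : Type*) {A M : Type*} [CommRing R] [CommRing A] [Algebra R A]
    [Module.Free R A] [Module.Finite R A] [AddCommGroup M] [Module A M] [Module R M]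
    [IsScalarTower R A M] [Module.Free A M] [Module.Finite A M] (f : M →ₗ[A] M) :
    LinearMap.trace R M (f.restrictScalars R) = Algebra.trace R A (LinearMap.trace A M f) := by
  classical
  let bA := Module.Free.chooseBasis R A
  let bM := Module.Free.chooseBasis A M
  rw [LinearMap.trace_eq_matrix_trace R (bA.smulTower' bM), LinearMap.restrictScalars_toMatrix,
    LinearMap.trace_eq_matrix_trace A bM]
  simp only [Matrix.trace, map_sum (Algebra.trace R A), Algebra.trace_eq_matrix_trace bA,
    Fintype.sum_prod_type]
  rfl

variable {d : ℕ}

lemma coe_tracelessHermProj (X : Op d) :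
    (tracelessHermProj d X : Op d) = (1 / 2 : ℝ) • (X + Xᴴ) - (X.trace.re / d) • (1 : Op d) :=
  rfl

lemma tracelessHermProj_of_mem {X : Op d} (hX : X ∈ tracelessHerm d) :
    (tracelessHermProj d X : Op d) = X := by
  rw [coe_tracelessHermProj, hX.2, hX.1.eq, Complex.zero_re, zero_div, zero_smul, sub_zero,
    ← two_smul ℝ, smul_smul]
  norm_num

lemma tracelessProj_apply (X : Op d) : tracelessProj d X = X - ((d : ℂ)⁻¹ * X.trace) • 1 := by
  simp [tracelessProj, dOuter, smul_smul]

lemma tracelessProj_eq_schurSuper :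
    tracelessProj d = schurSuper (fun _ _ => 1) (1 - fiberMean ℝ (fun _ : Fin d => ())) := by
  refine LinearMap.ext fun X => ?_
  ext i j
  rw [tracelessProj_apply, Matrix.sub_apply, Matrix.smul_apply]
  rcases eq_or_ne i j with rfl | h
  · simp only [schurSuper_apply_self, Matrix.sub_apply, Matrix.one_apply, fiberMean_unit_apply]
    simp [sub_mul, Finset.sum_sub_distrib, apply_ite Complex.ofReal, ← Finset.mul_sum,
      Matrix.trace]
  · simp [schurSuper_apply_of_ne _ h, h]

lemma tracelessProj_eq_partitionSuper {κ : Type*} [DecidableEq κ] (σ : Fin d → κ) :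
    tracelessProj d = partitionSuper σ 1 1 0 := by
  rw [tracelessProj_eq_schurSuper, ← spectralMatrix_one_one_zero σ]
  rfl

lemma tracelessProj_of_mem {X : Op d} (hX : X ∈ tracelessHerm d) : tracelessProj d X = X := by
  rw [tracelessProj_apply, hX.2, mul_zero, zero_smul, sub_zero]

lemma restrictTH_mul (O : SuperOp d) {O' : SuperOp d}
    (hO' : ∀ X ∈ tracelessHerm d, O' X ∈ tracelessHerm d) :
    restrictTH (O * O') = restrictTH O * restrictTH O' := by
  refine LinearMap.ext fun x => ?_
  change tracelessHermProj d (O (O' x))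
    = tracelessHermProj d (O (tracelessHermProj d (O' x) : Op d))
  rw [tracelessHermProj_of_mem (hO' x x.2)]

lemma tracelessHermProj_add_I_smul (X : Op d) :
    (tracelessHermProj d X : Op d) + Complex.I • (tracelessHermProj d (-Complex.I • X) : Op d)
      = tracelessProj d X := by
  have htrace : ((X.trace.re : ℝ) : ℂ) + (((-Complex.I • X).trace.re : ℝ) : ℂ) * Complex.I
      = X.trace := by
    simp [Complex.re_add_im]
  rw [tracelessProj_apply, ← htrace, coe_tracelessHermProj, coe_tracelessHermProj]
  ext i j
  simp only [Matrix.add_apply, Matrix.sub_apply, Matrix.smul_apply, Matrix.conjTranspose_apply,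
    smul_eq_mul, Complex.real_smul, star_mul', Complex.star_def, map_neg, Complex.conj_I]
  push_cast
  linear_combination (1 / 2 * X i j - 1 / 2 * (starRingEnd ℂ) (X j i)) * -Complex.I_sq

lemma apply_tracelessProj {O : SuperOp d} (hO : O 1 = 0) (X : Op d) :
    O (tracelessProj d X) = O X := by
  rw [tracelessProj_apply, map_sub, map_smul, hO, smul_zero, sub_zero]

theorem trace_restrictTH {O : SuperOp d} (hO : O 1 = 0) :
    LinearMap.trace ℝ (tracelessHerm d) (restrictTH O)
      = (LinearMap.trace ℂ (Op d) O).re := by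
  let ι := (tracelessHerm d).subtype
  let p := tracelessHermProj d
  let OR : Module.End ℝ (Op d) := O.restrictScalars ℝ
  let J : Module.End ℝ (Op d) := (Complex.I • (1 : SuperOp d)).restrictScalars ℝ
  let J' : Module.End ℝ (Op d) := (-Complex.I • (1 : SuperOp d)).restrictScalars ℝ
  have hJ : J' * J = 1 := by
    refine LinearMap.ext fun X => ?_
    change -Complex.I • Complex.I • X = X
    simp [smul_smul]
  -- The operators are the complexification of the Hermitian ones.
  have hsplit : OR = OR * (ι ∘ₗ p) + J * (OR * (ι ∘ₗ p) * J') := by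
    refine LinearMap.ext fun X => ?_
    change O X = O (p X : Op d) + Complex.I • O (p (-Complex.I • X) : Op d)
    rw [← map_smul, ← map_add, tracelessHermProj_add_I_smul, apply_tracelessProj hO]
  have hpart : LinearMap.trace ℝ (Op d) (OR * (ι ∘ₗ p))
      = LinearMap.trace ℝ (tracelessHerm d) (restrictTH O) :=
    LinearMap.trace_comp_comm' p (OR ∘ₗ ι)
  have htrace : LinearMap.trace ℝ (Op d) OR = 2 * (LinearMap.trace ℂ (Op d) O).re := by
    rw [trace_restrictScalars, Algebra.trace_complex_apply]
  rw [hsplit, map_add, LinearMap.trace_mul_comm ℝ J, mul_assoc, hJ, mul_one, hpart] at htrace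
  linarith

end TracelessHermitian

section TwoBlocks

/-- The block of an index: `0` for the first `r` ones and `1` for the others. -/
def blockIndex (d r : ℕ) (i : Fin d) : Fin 2 := if i.val < r then 0 else 1

lemma fiberCard_blockIndex_zero {d r : ℕ} (hrd : r ≤ d) : fiberCard (blockIndex d r) 0 = r := by
  have hfilter (i : Fin d) : blockIndex d r i = 0 ↔ i.val < r := by simp [blockIndex]
  simp_rw [fiberCard, hfilter]
  rw [Fin.card_filter_val_lt, min_eq_right hrd]

lemma fiberCard_blockIndex_one {d r : ℕ} (hrd : r ≤ d) :
    fiberCard (blockIndex d r) 1 = d - r := by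
  have h : d = fiberCard (blockIndex d r) 0 + fiberCard (blockIndex d r) 1 := by
    simpa using sum_comp_eq_sum_fiberCard (blockIndex d r) fun _ => (1 : ℕ)
  rw [fiberCard_blockIndex_zero hrd] at h
  omega

lemma surjective_blockIndex {d r : ℕ} (hr : 0 < r) (hrd : r < d) :
    Function.Surjective (blockIndex d r) := by
  intro c
  fin_cases c
  · exact ⟨⟨0, hr.trans hrd⟩, if_pos hr⟩
  · exact ⟨⟨r, hrd⟩, if_neg (lt_irrefl r)⟩

variable (d r : ℕ)

/-- The superoperator with eigenvalues `x 0` and `x 2` on the traceless operators supported in the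
first and in the second diagonal block, `x 1` on the off-diagonal blocks, `x 3` on the traceless
operators which are scalar on both blocks, and `0` on the identity. -/
def spectralSuper (x : Fin 4 → ℝ) : SuperOp d :=
  partitionSuper (blockIndex d r) ![![x 0, x 1], ![x 1, x 2]] (x 3) 0

lemma spectralSuper_add (x y : Fin 4 → ℝ) :
    spectralSuper d r (x + y) = spectralSuper d r x + spectralSuper d r y := by
  rw [spectralSuper, spectralSuper, spectralSuper, ← partitionSuper_add, add_zero]
  congr 1
  ext c c'
  fin_cases c <;> fin_cases c' <;> rfl

lemma spectralSuper_mul (x y : Fin 4 → ℝ) :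
    spectralSuper d r x * spectralSuper d r y = spectralSuper d r (x * y) := by
  rw [spectralSuper, spectralSuper, spectralSuper, partitionSuper_mul, mul_zero]
  congr 1
  ext c c'
  fin_cases c <;> fin_cases c' <;> rfl

lemma spectralSuper_smul (t : ℝ) (x : Fin 4 → ℝ) :
    spectralSuper d r (t • x) = t • spectralSuper d r x := by
  rw [Algebra.smul_def t (spectralSuper d r x), ← partitionSuper_const (blockIndex d r),
    spectralSuper, spectralSuper, partitionSuper_mul, mul_zero]
  congr 1
  ext c c'
  fin_cases c <;> fin_cases c' <;> rfl

lemma spectralSuper_one : spectralSuper d r 1 = tracelessProj d := by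
  rw [tracelessProj_eq_partitionSuper (blockIndex d r), spectralSuper]
  congr 1
  ext c c'
  fin_cases c <;> fin_cases c' <;> rfl

lemma spectralSuper_apply_one (x : Fin 4 → ℝ) : spectralSuper d r x 1 = 0 :=
  partitionSuper_one _ _ _

variable {d r}

lemma spectralSuper_mem_tracelessHerm (x : Fin 4 → ℝ) {X : Op d} (hX : X.IsHermitian) :
    spectralSuper d r x X ∈ tracelessHerm d := by
  refine partitionSuper_mem_tracelessHerm (fun c c' => ?_) hX
  fin_cases c <;> fin_cases c' <;> rfl

lemma restrictTH_tracelessProj : restrictTH (tracelessProj d) = 1 :=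
  LinearMap.ext fun x => Subtype.ext <| by
    change (tracelessHermProj d (tracelessProj d x) : Op d) = x
    rw [tracelessProj_of_mem x.2, tracelessHermProj_of_mem x.2]

/-- The restriction of `spectralSuper d r` to the traceless Hermitian operators, as an algebra
homomorphism. -/
def restrictedSpectralSuper (d r : ℕ) : (Fin 4 → ℝ) →ₐ[ℝ] Module.End ℝ (tracelessHerm d) :=
  AlgHom.ofLinearMap
    { toFun := fun x => restrictTH (spectralSuper d r x)
      map_add' := fun x y => by
        rw [spectralSuper_add]
        exact LinearMap.ext fun X => map_add (tracelessHermProj d) _ _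
      map_smul' := fun t x => by
        rw [spectralSuper_smul]
        exact LinearMap.ext fun X => map_smul (tracelessHermProj d) _ _ }
    (by
      change restrictTH (spectralSuper d r 1) = 1
      rw [spectralSuper_one, restrictTH_tracelessProj])
    (fun x y => by
      change restrictTH (spectralSuper d r (x * y)) = _
      rw [← spectralSuper_mul, restrictTH_mul _ fun X hX => spectralSuper_mem_tracelessHerm y hX.1]
      rfl)

lemma trace_schurSuper_diagonal_mul_spectralSuper (hr : 0 < r) (hrd : r < d)
    {U : Fin 2 → Fin 2 → ℝ} (hU : U 1 0 = U 0 1) (x : Fin 4 → ℝ) :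
    (LinearMap.trace ℂ (Op d) (schurSuper (fun i j => U (blockIndex d r i) (blockIndex d r j))
        (Matrix.diagonal ((fun c => U c c) ∘ blockIndex d r)) * spectralSuper d r x)).re
      = ((r : ℝ) ^ 2 - 1) * (U 0 0 * x 0) + 2 * r * ((d : ℝ) - r) * (U 0 1 * x 1)
        + (((d : ℝ) - r) ^ 2 - 1) * (U 1 1 * x 2)
        + (((d : ℝ) - r) / d * U 0 0 + r / d * U 1 1) * x 3 := by
  have hd : (d : ℝ) ≠ 0 := Nat.cast_ne_zero.2 (hr.trans hrd).ne'
  rw [spectralSuper, trace_schurSuper_diagonal_mul_partitionSuper _ _ _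
    (surjective_blockIndex hr hrd), Complex.ofReal_re]
  simp only [Fin.sum_univ_two, fiberCard_blockIndex_zero hrd.le, fiberCard_blockIndex_one hrd.le,
    Nat.cast_sub hrd.le, hU, Matrix.cons_val_zero, Matrix.cons_val_one]
  field_simp
  ring

lemma trace_spectralSuper (hr : 0 < r) (hrd : r < d) (x : Fin 4 → ℝ) :
    (LinearMap.trace ℂ (Op d) (spectralSuper d r x)).re
      = ((r : ℝ) ^ 2 - 1) * x 0 + 2 * r * ((d : ℝ) - r) * x 1
        + (((d : ℝ) - r) ^ 2 - 1) * x 2 + x 3 := by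
  have hd : (d : ℝ) ≠ 0 := Nat.cast_ne_zero.2 (hr.trans hrd).ne'
  have hone : schurSuper (fun _ _ => 1) (Matrix.diagonal fun _ : Fin d => 1) = 1 :=
    (schurSuper_scalar 1).trans (map_one _)
  have h := trace_schurSuper_diagonal_mul_spectralSuper hr hrd (U := fun _ _ => 1) rfl x
  simp only [Function.comp_def, hone, one_mul, mul_one] at h
  rw [h, ← add_div, sub_add_cancel, div_self hd, one_mul]

/-- The dimensions of the eigenspaces of `spectralSuper d r x` on the traceless operators. -/
def spectralMultiplicity (d r : ℕ) : Fin 4 → ℕ :=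
  ![r ^ 2 - 1, 2 * r * (d - r), (d - r) ^ 2 - 1, 1]

lemma cast_spectralMultiplicity (hr : 0 < r) (hrd : r < d) (i : Fin 4) :
    (spectralMultiplicity d r i : ℝ)
      = ![(r : ℝ) ^ 2 - 1, 2 * r * ((d : ℝ) - r), ((d : ℝ) - r) ^ 2 - 1, 1] i := by
  have hr' : 1 ≤ r ^ 2 := Nat.one_le_pow _ _ hr
  have hdr : 1 ≤ (d - r) ^ 2 := Nat.one_le_pow _ _ (Nat.sub_pos_of_lt hrd)
  fin_cases i <;> simp [spectralMultiplicity, Nat.cast_sub, hr', hdr, hrd.le]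

lemma prod_pow_spectralMultiplicity {M : Type*} [CommMonoid M] (f : Fin 4 → M) :
    ∏ i, f i ^ spectralMultiplicity d r i
      = f 0 ^ (r ^ 2 - 1) * f 1 ^ (2 * r * (d - r)) * f 2 ^ ((d - r) ^ 2 - 1) * f 3 := by
  rw [Fin.prod_univ_four]
  exact congrArg (_ * ·) (pow_one (f 3))

lemma sum_spectralMultiplicity_mul (hr : 0 < r) (hrd : r < d) (f : Fin 4 → ℝ) :
    ∑ i, spectralMultiplicity d r i * f i
      = ((r : ℝ) ^ 2 - 1) * f 0 + 2 * r * ((d : ℝ) - r) * f 1 + (((d : ℝ) - r) ^ 2 - 1) * f 2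
        + f 3 := by
  simp_rw [cast_spectralMultiplicity hr hrd]
  rw [Fin.sum_univ_four]
  exact congrArg (_ + ·) (one_mul (f 3))

lemma trace_restrictedSpectralSuper_single (hr : 0 < r) (hrd : r < d) (i : Fin 4) :
    LinearMap.trace ℝ _ (restrictedSpectralSuper d r (Pi.single i 1))
      = spectralMultiplicity d r i := by
  change LinearMap.trace ℝ _ (restrictTH (spectralSuper d r (Pi.single i 1))) = _
  rw [trace_restrictTH (spectralSuper_apply_one d r _), trace_spectralSuper hr hrd,
    cast_spectralMultiplicity hr hrd]
  fin_cases i <;> simp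

lemma charpoly_restrictTH_spectralSuper (hr : 0 < r) (hrd : r < d) (x : Fin 4 → ℝ) :
    (restrictTH (spectralSuper d r x)).charpoly
      = ∏ i, (Polynomial.X - Polynomial.C (x i)) ^ spectralMultiplicity d r i :=
  charpoly_algHom_pi (trace_restrictedSpectralSuper_single hr hrd) x

lemma det_restrictTH_spectralSuper (hr : 0 < r) (hrd : r < d) (x : Fin 4 → ℝ) :
    LinearMap.det (restrictTH (spectralSuper d r x)) = ∏ i, x i ^ spectralMultiplicity d r i :=
  det_algHom_pi (trace_restrictedSpectralSuper_single hr hrd) x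

end TwoBlocks

/-! ### The frame superoperator -/

section HaarIntegral

variable {d : ℕ}

lemma dOuter_apply (A B X : Op d) : dOuter A B X = (Bᴴ * X).trace • A := rfl

lemma trace_conjTranspose_mul_E (B : Op d) (k l : Fin d) : (Bᴴ * E k l).trace = star (B k l) := by
  simp [E, Matrix.trace_mul_single]

lemma trace_E_conjTranspose_mul (X : Op d) (k l : Fin d) : ((E k l)ᴴ * X).trace = X k l := by
  simp [E, Matrix.trace_single_mul]

lemma superOp_ext {S T : SuperOp d} (h : ∀ k l i j, S (E k l) i j = T (E k l) i j) : S = T := by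
  refine Matrix.ext_linearMap ℂ fun k l => LinearMap.ext_ring ?_
  ext i j
  exact h k l i j

lemma superOp_apply_apply (G : SuperOp d) (X : Op d) (i j : Fin d) :
    G X i j = ∑ k, ∑ l, X k l * G (E k l) i j := by
  have hX : X = ∑ k, ∑ l, X k l • E k l := by
    simpa only [E, Matrix.smul_single, smul_eq_mul, mul_one] using Matrix.matrix_eq_sum_single X
  conv_lhs => rw [hX]
  simp only [map_sum, map_smul, Matrix.sum_apply, Matrix.smul_apply, smul_eq_mul]

lemma haarIntegral_apply_E (T : PureState d → SuperOp d) (k l i j : Fin d) :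
    haarIntegral T (E k l) i j = ∫ ψ, T ψ (E k l) i j ∂haarPure d := by
  simp only [haarIntegral, LinearMap.sum_apply, LinearMap.smul_apply, dOuter_apply,
    trace_E_conjTranspose_mul, Matrix.sum_apply, Matrix.smul_apply, smul_eq_mul]
  simp [E, Matrix.single_apply, ite_and]

variable {T : PureState d → SuperOp d}

lemma integrable_superOp_apply
    (hT : ∀ k l i j, Integrable (fun ψ => T ψ (E k l) i j) (haarPure d)) (X : Op d) (i j : Fin d) :
    Integrable (fun ψ => T ψ X i j) (haarPure d) := by
  simp_rw [fun ψ => superOp_apply_apply (T ψ) X i j]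
  exact integrable_finsetSum _ fun k _ => integrable_finsetSum _ fun l _ => (hT k l i j).const_mul _

lemma haarIntegral_apply
    (hT : ∀ k l i j, Integrable (fun ψ => T ψ (E k l) i j) (haarPure d)) (X : Op d) (i j : Fin d) :
    haarIntegral T X i j = ∫ ψ, T ψ X i j ∂haarPure d := by
  have hint (k l : Fin d) : Integrable (fun ψ => X k l * T ψ (E k l) i j) (haarPure d) :=
    (hT k l i j).const_mul _
  simp_rw [superOp_apply_apply _ X i j]
  rw [integral_finsetSum _ fun k _ => integrable_finsetSum _ fun l _ => hint k l]
  refine Finset.sum_congr rfl fun k _ => ?_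
  rw [integral_finsetSum _ fun l _ => hint k l]
  simp_rw [integral_const_mul, haarIntegral_apply_E]

lemma haarIntegral_mul_mul (G H : SuperOp d)
    (hT : ∀ k l i j, Integrable (fun ψ => T ψ (E k l) i j) (haarPure d)) :
    haarIntegral (fun ψ => G * T ψ * H) = G * haarIntegral T * H := by
  refine superOp_ext fun k l i j => ?_
  have hint (a b : Fin d) :
      Integrable (fun ψ => T ψ (H (E k l)) a b * G (E a b) i j) (haarPure d) :=
    (integrable_superOp_apply hT _ a b).mul_const _
  simp_rw [haarIntegral_apply_E, Module.End.mul_apply]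
  rw [superOp_apply_apply G]
  simp_rw [fun ψ => superOp_apply_apply G (T ψ (H (E k l))) i j]
  rw [integral_finsetSum _ fun a _ => integrable_finsetSum _ fun b _ => hint a b]
  refine Finset.sum_congr rfl fun a _ => ?_
  rw [integral_finsetSum _ fun b _ => hint a b]
  simp_rw [integral_mul_const, haarIntegral_apply hT]

lemma trace_conjTranspose_mul_haarIntegral
    (hT : ∀ k l i j, Integrable (fun ψ => T ψ (E k l) i j) (haarPure d)) (X Y : Op d) :
    (Xᴴ * haarIntegral T Y).trace = ∫ ψ, (Xᴴ * T ψ Y).trace ∂haarPure d := by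
  have hint (i j : Fin d) : Integrable (fun ψ => Xᴴ i j * T ψ Y j i) (haarPure d) :=
    (integrable_superOp_apply hT Y j i).const_mul _
  simp only [Matrix.trace, Matrix.diag_apply, Matrix.mul_apply]
  rw [integral_finsetSum _ fun i _ => integrable_finsetSum _ fun j _ => hint i j]
  refine Finset.sum_congr rfl fun i _ => ?_
  rw [integral_finsetSum _ fun j _ => hint i j]
  simp_rw [integral_const_mul, haarIntegral_apply hT]

lemma trace_conjTranspose_haarIntegral_mul
    (hT : ∀ k l i j, Integrable (fun ψ => T ψ (E k l) i j) (haarPure d)) (X Y : Op d) :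
    ((haarIntegral T X)ᴴ * Y).trace = ∫ ψ, ((T ψ X)ᴴ * Y).trace ∂haarPure d := by
  have hstar (Z : Op d) : (Zᴴ * Y).trace = star (Yᴴ * Z).trace := by
    rw [← Matrix.trace_conjTranspose, Matrix.conjTranspose_mul, Matrix.conjTranspose_conjTranspose]
  simp_rw [hstar, trace_conjTranspose_mul_haarIntegral hT, Complex.star_def, integral_conj]

end HaarIntegral

section Frame

variable {d : ℕ} {ρ : Op d}

lemma continuous_ketbra_apply (i j : Fin d) :
    Continuous fun ψ : PureState d => ketbra ψ i j := by
  simp only [ketbra, Matrix.of_apply]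
  fun_prop

lemma isHermitian_ketbra (ψ : PureState d) : (ketbra ψ).IsHermitian := by
  ext i j
  simp [ketbra, mul_comm]

lemma ofReal_born (hρ : ρ.IsHermitian) (ψ : PureState d) :
    ((born ρ ψ : ℝ) : ℂ) = (ketbra ψ * ρ).trace := by
  refine Complex.conj_eq_iff_re.1 ?_
  rw [← Complex.star_def, ← Matrix.trace_conjTranspose, Matrix.conjTranspose_mul, hρ.eq,
    (isHermitian_ketbra ψ).eq, Matrix.trace_mul_comm]

lemma continuous_born (ρ : Op d) : Continuous (born ρ) := by
  refine Complex.continuous_re.comp ?_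
  simp only [Matrix.trace, Matrix.diag_apply, Matrix.mul_apply]
  exact continuous_finsetSum _ fun i _ => continuous_finsetSum _ fun j _ =>
    (continuous_ketbra_apply i j).mul continuous_const

lemma integrable_of_continuous (hd : 0 < d) {f : PureState d → ℂ} (hf : Continuous f) :
    Integrable f (haarPure d) := by
  have := isProbabilityMeasure_haarPure hd
  exact hf.integrable_of_hasCompactSupport (HasCompactSupport.of_compactSpace f)

lemma integrable_inv_born_smul_dOuter (hd : 0 < d) (hborn : ∀ ψ, born ρ ψ ≠ 0) (k l i j : Fin d) :
    Integrable (fun ψ => ((((born ρ ψ)⁻¹ : ℝ) : ℂ) • dOuter (ketbra ψ) (ketbra ψ)) (E k l) i j)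
      (haarPure d) := by
  simp only [LinearMap.smul_apply, dOuter_apply, trace_conjTranspose_mul_E, Matrix.smul_apply,
    smul_eq_mul]
  exact integrable_of_continuous hd <|
    (Complex.continuous_ofReal.comp ((continuous_born ρ).inv₀ hborn)).mul <|
      (continuous_star.comp (continuous_ketbra_apply k l)).mul (continuous_ketbra_apply i j)

lemma dOuter_map_map {G : SuperOp d}
    (hG : ∀ X Y : Op d, (Xᴴ * G Y).trace = ((G X)ᴴ * Y).trace) (A B : Op d) :
    dOuter (G A) (G B) = G * dOuter A B * G := by
  refine LinearMap.ext fun X => ?_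
  rw [Module.End.mul_apply, Module.End.mul_apply, dOuter_apply, dOuter_apply, map_smul, hG]

lemma trace_conjTranspose_mul_dOuter_self (A X Y : Op d) :
    (Xᴴ * dOuter A A Y).trace = ((dOuter A A X)ᴴ * Y).trace := by
  rw [dOuter_apply, dOuter_apply, Matrix.conjTranspose_smul, ← Matrix.trace_conjTranspose,
    Matrix.conjTranspose_mul, Matrix.conjTranspose_conjTranspose, Matrix.mul_smul,
    Matrix.smul_mul, Matrix.trace_smul, Matrix.trace_smul, smul_eq_mul, smul_eq_mul, mul_comm]

lemma trace_conjTranspose_mul_frame (hd : 0 < d) (hborn : ∀ ψ, born ρ ψ ≠ 0) (X Y : Op d) :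
    (Xᴴ * frame ρ Y).trace = ((frame ρ X)ᴴ * Y).trace := by
  have hint := integrable_inv_born_smul_dOuter hd hborn
  rw [frame, LinearMap.smul_apply, LinearMap.smul_apply, Matrix.conjTranspose_smul,
    Matrix.mul_smul, Matrix.smul_mul, Matrix.trace_smul, Matrix.trace_smul, star_natCast,
    trace_conjTranspose_mul_haarIntegral hint, trace_conjTranspose_haarIntegral_mul hint]
  simp only [LinearMap.smul_apply, Matrix.conjTranspose_smul, Matrix.mul_smul, Matrix.smul_mul,
    Matrix.trace_smul, trace_conjTranspose_mul_dOuter_self, Complex.star_def, Complex.conj_ofReal]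

lemma smul_dOuter_inv_smul {p : ℝ} (hp : p ≠ 0) (A : Op d) :
    (p : ℂ) • dOuter (((p⁻¹ : ℝ) : ℂ) • A) (((p⁻¹ : ℝ) : ℂ) • A)
      = ((p⁻¹ : ℝ) : ℂ) • dOuter A A := by
  have hp' : (p : ℂ) ≠ 0 := Complex.ofReal_ne_zero.2 hp
  refine LinearMap.ext fun X => ?_
  simp only [LinearMap.smul_apply, dOuter_apply, Matrix.conjTranspose_smul, Matrix.smul_mul,
    Matrix.trace_smul, smul_smul, Complex.star_def, Complex.conj_ofReal, smul_eq_mul]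
  congr 1
  rw [Complex.ofReal_inv]
  field_simp

theorem blueMatrix_eq_sub_dOuter (hd : 0 < d) (hborn : ∀ ψ, born ρ ψ ≠ 0) {G : SuperOp d}
    (hmul : frame ρ * G = 1) : blueMatrix ρ = G - dOuter ρ ρ := by
  have hmul' : G * frame ρ = 1 := mul_eq_one_comm.1 hmul
  have hinv : Ring.inverse (frame ρ) = G := Ring.inverse_unit ⟨frame ρ, G, hmul, hmul'⟩
  have hFG (X : Op d) : frame ρ (G X) = X := LinearMap.congr_fun hmul X
  have hG (X Y : Op d) : (Xᴴ * G Y).trace = ((G X)ᴴ * Y).trace := by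
    rw [← hFG X, ← trace_conjTranspose_mul_frame hd hborn, hFG, hFG]
  have hintegrand (ψ : PureState d) : ((born ρ ψ : ℝ) : ℂ) • dOuter (optRec ρ ψ) (optRec ρ ψ)
      = G * ((((born ρ ψ)⁻¹ : ℝ) : ℂ) • dOuter (ketbra ψ) (ketbra ψ)) * G := by
    rw [optRec, hinv, smul_dOuter_inv_smul (hborn ψ), dOuter_map_map hG, mul_smul_comm,
      smul_mul_assoc]
  have hframe : (d : ℂ) • (G * haarIntegral (fun ψ =>
      (((born ρ ψ)⁻¹ : ℝ) : ℂ) • dOuter (ketbra ψ) (ketbra ψ)) * G) = G * frame ρ * G := by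
    rw [frame, mul_smul_comm, smul_mul_assoc]
  simp_rw [blueMatrix, mseMatrix, hintegrand]
  rw [haarIntegral_mul_mul _ _ (integrable_inv_born_smul_dOuter hd hborn), hframe, hmul', one_mul]

end Frame

section DiagonalState

variable {d : ℕ}

/-- The exponents of the monomial `ψ_l ψ_i`. -/
def pairExp (l i m : Fin d) : ℕ := (if m = l then 1 else 0) + (if m = i then 1 else 0)

lemma monomial_pairExp (l i k j : Fin d) (x : EuclideanSpace ℂ (Fin d)) :
    monomial (pairExp l i) (pairExp k j) x = star (x k * star (x l)) * (x i * star (x j)) := by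
  simp only [monomial, pairExp, pow_add, Finset.prod_mul_distrib, pow_ite, pow_one, pow_zero,
    Finset.prod_ite_eq', Finset.mem_univ, if_true, star_mul', star_star]
  ring

lemma pairExp_comm (l i : Fin d) : pairExp l i = pairExp i l :=
  funext fun _ => add_comm _ _

lemma pairExp_eq_iff {l i k j : Fin d} :
    pairExp l i = pairExp k j ↔ (l = k ∧ i = j) ∨ (l = j ∧ i = k) := by
  constructor
  · intro h
    have hl := congrFun h l
    have hi := congrFun h i
    have hk := congrFun h k
    have hj := congrFun h j
    simp only [pairExp] at hl hi hk hj
    grind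
  · rintro (⟨rfl, rfl⟩ | ⟨rfl, rfl⟩)
    · rfl
    · exact pairExp_comm _ _

lemma sum_pairExp (l i k j : Fin d) : ∑ m, (pairExp l i m + pairExp k j m) = 2 * 2 := by
  simp [pairExp, Finset.sum_add_distrib]

lemma prod_factorial_pairExp (l i : Fin d) :
    ∏ m, ((pairExp l i m).factorial : ℝ) = 1 + if l = i then 1 else 0 := by
  rw [Finset.prod_eq_single l]
  · rcases eq_or_ne l i with rfl | h
    · norm_num [pairExp]
    · simp [pairExp, h]
  · intro m _ hm
    rw [pairExp, if_neg hm]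
    split_ifs <;> simp
  · simp

lemma prod_pow_pairExp (l i : Fin d) (x : Fin d → ℝ) :
    ∏ m, x m ^ (pairExp l i m + 1) = x l * x i * ∏ m, x m := by
  simp only [pairExp, pow_add, Finset.prod_mul_distrib, pow_ite, pow_one, pow_zero,
    Finset.prod_ite_eq', Finset.mem_univ, if_true]

lemma isHermitian_diagonal_ofReal (w : Fin d → ℝ) :
    (Matrix.diagonal fun m => (w m : ℂ)).IsHermitian := by
  rw [Matrix.isHermitian_diagonal_iff]
  exact fun m => Complex.conj_ofReal (w m)

lemma born_diagonal (w : Fin d → ℝ) (ψ : PureState d) :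
    born (Matrix.diagonal fun m => (w m : ℂ)) ψ = weightedNormSq w ψ.1 := by
  rw [born, Matrix.trace, Complex.re_sum, weightedNormSq]
  refine Finset.sum_congr rfl fun m _ => ?_
  rw [Matrix.diag_apply, Matrix.mul_diagonal, ketbra, Matrix.of_apply, Complex.star_def,
    Complex.mul_conj, ← Complex.ofReal_mul, Complex.ofReal_re, Complex.normSq_eq_norm_sq, mul_comm]

/-- The entries of the frame superoperator of the diagonal state with eigenvalues `w`: off the
diagonal it multiplies the `(i, j)` entry by `frameValue w i j`. -/
def frameValue (w : Fin d → ℝ) (i j : Fin d) : ℝ :=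
  ∫ z in Set.Ioi (0 : ℝ), ((1 + z * w i) * (1 + z * w j) * ∏ m, (1 + z * w m))⁻¹

lemma frameValue_comm (w : Fin d → ℝ) (i j : Fin d) : frameValue w i j = frameValue w j i := by
  simp only [frameValue, mul_comm (1 + _ * w i)]

variable {w : Fin d → ℝ} (hw : ∀ m, 0 < w m)
include hw

lemma born_diagonal_ne_zero (ψ : PureState d) :
    born (Matrix.diagonal fun m => (w m : ℂ)) ψ ≠ 0 := by
  rw [born_diagonal]
  exact (weightedNormSq_sphere_pos hw ψ).ne'

lemma integral_inv_one_add_mul_pow_smul_monomial (hd : 0 < d) {p q : Fin d → ℕ}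
    (hpq : ∑ m, (p m + q m) = 2 * 2) {z : ℝ} (hz : 0 < z) :
    ∫ ψ : PureState d, ((1 + z * weightedNormSq w ψ.1) ^ (d + 2))⁻¹ • monomial p q ψ.1 ∂haarPure d
      = ((d : ℂ) * (d + 1))⁻¹ * ((∏ m, if p m = q m then
          (p m).factorial / (1 + z * w m) ^ (p m + 1) else 0 : ℝ) : ℂ) := by
  have hfactorial : ((d - 1).factorial / (d + 2 - 1).factorial : ℝ) = ((d : ℝ) * (d + 1))⁻¹ := by
    obtain ⟨n, rfl⟩ : ∃ n, d = n + 1 := ⟨d - 1, by omega⟩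
    rw [show n + 1 + 2 - 1 = n + 2 by omega, Nat.add_sub_cancel, Nat.factorial_succ,
      Nat.factorial_succ]
    push_cast
    field_simp [Nat.factorial_ne_zero]
  simp_rw [Complex.real_smul, ← weightedNormSq_one_add_mul_sphere, mul_comm _ (monomial p q _)]
  rw [integral_haarPure_monomial hd (fun m => add_pos one_pos (mul_pos hz (hw m))) hpq, hfactorial]
  push_cast
  rfl

lemma integral_inv_weightedNormSq_mul_monomial (hd : 0 < d) {p q : Fin d → ℕ}
    (hpq : ∑ m, (p m + q m) = 2 * 2) :
    (d : ℂ) * ∫ ψ : PureState d, (((weightedNormSq w ψ.1)⁻¹ : ℝ) : ℂ) * monomial p q ψ.1 ∂haarPure d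
      = ((∫ z in Set.Ioi (0 : ℝ), ∏ m, if p m = q m then
          (p m).factorial / (1 + z * w m) ^ (p m + 1) else 0 : ℝ) : ℂ) := by
  have : Nonempty (Fin d) := ⟨⟨0, hd⟩⟩
  have := isProbabilityMeasure_haarPure hd
  obtain ⟨m₀, hm₀⟩ := Finite.exists_min w
  have hd' : (d : ℂ) ≠ 0 := Nat.cast_ne_zero.2 hd.ne'
  have hd1 : (d : ℂ) + 1 ≠ 0 := Nat.cast_add_one_ne_zero d
  have hswap := integral_inv_smul_eq_integral_integral (μ := haarPure d)
    (p := fun ψ => weightedNormSq w ψ.1) (M := fun ψ => monomial p q ψ.1) (hw m₀) d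
    ((continuous_weightedNormSq w).comp continuous_subtype_val).measurable
    (Eventually.of_forall (le_weightedNormSq_sphere hm₀))
    (integrable_of_continuous hd ((continuous_monomial p q).comp continuous_subtype_val))
  rw [setIntegral_congr_fun measurableSet_Ioi fun z (hz : 0 < z) =>
    integral_inv_one_add_mul_pow_smul_monomial hw hd hpq hz, integral_const_mul,
    integral_complex_ofReal] at hswap
  simp_rw [← Complex.real_smul]
  rw [hswap, Complex.real_smul]
  push_cast
  field_simp

lemma frame_diagonal_apply_E (hd : 0 < d) (k l i j : Fin d) :
    frame (Matrix.diagonal fun m => (w m : ℂ)) (E k l) i j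
      = if pairExp l i = pairExp k j then
          (((1 + if l = i then 1 else 0) * frameValue w l i : ℝ) : ℂ) else 0 := by
  have hintegrand (ψ : PureState d) :
      ((((weightedNormSq w ψ.1)⁻¹ : ℝ) : ℂ) • dOuter (ketbra ψ) (ketbra ψ)) (E k l) i j
        = (((weightedNormSq w ψ.1)⁻¹ : ℝ) : ℂ) * monomial (pairExp l i) (pairExp k j) ψ.1 := by
    rw [monomial_pairExp, LinearMap.smul_apply, dOuter_apply, trace_conjTranspose_mul_E]
    rfl
  rw [frame, LinearMap.smul_apply, Matrix.smul_apply, haarIntegral_apply_E, smul_eq_mul]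
  simp_rw [born_diagonal, hintegrand]
  rw [integral_inv_weightedNormSq_mul_monomial hw hd (sum_pairExp l i k j)]
  rcases eq_or_ne (pairExp l i) (pairExp k j) with h | h
  · rw [if_pos h, frameValue, ← integral_const_mul]
    simp_rw [← h, if_true, Finset.prod_div_distrib, prod_factorial_pairExp, prod_pow_pairExp,
      div_eq_mul_inv]
  · obtain ⟨m, hm⟩ := Function.ne_iff.1 h
    rw [if_neg h]
    simp_rw [fun z : ℝ => Finset.prod_eq_zero (Finset.mem_univ m)
      (f := fun m => if pairExp l i m = pairExp k j m then
        ((pairExp l i m).factorial / (1 + z * w m) ^ (pairExp l i m + 1) : ℝ) else 0) (if_neg hm)]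
    rw [integral_zero, Complex.ofReal_zero]

theorem frame_diagonal (hd : 0 < d) : frame (Matrix.diagonal fun m => (w m : ℂ))
    = schurSuper (frameValue w)
        (Matrix.of fun i j => (1 + if i = j then 1 else 0) * frameValue w i j) := by
  refine superOp_ext fun k l i j => ?_
  rw [frame_diagonal_apply_E hw hd]
  simp only [pairExp_eq_iff]
  rcases eq_or_ne i j with rfl | hij
  · simp only [schurSuper_apply_self, E, Matrix.single_apply, Matrix.of_apply]
    rcases eq_or_ne k l with rfl | hkl
    · rw [Finset.sum_eq_single k (fun m _ hm => by simp [hm.symm]) (by simp)]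
      simp [frameValue_comm w k i, eq_comm]
    · have hdiag (m : Fin d) : ¬(k = m ∧ l = m) := fun h => hkl (h.1.trans h.2.symm)
      simp only [hdiag, if_false, mul_zero, Finset.sum_const_zero]
      exact if_neg (by grind)
  · rw [schurSuper_apply_of_ne _ hij, E, Matrix.single_apply]
    rcases em (k = i ∧ l = j) with ⟨rfl, rfl⟩ | hkl
    · simp [hij.symm, frameValue_comm w k l]
    · rw [if_neg hkl, mul_zero, if_neg]
      rintro (⟨-, h⟩ | ⟨hl, hi⟩)
      · exact hij h
      · exact hkl ⟨hi.symm, hl⟩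

end DiagonalState

section FrameInverse

variable {d : ℕ} {ρ : Op d}

lemma integral_ketbra_apply (hd : 0 < d) (i j : Fin d) :
    ∫ ψ, ketbra ψ i j ∂haarPure d = if i = j then (d : ℂ)⁻¹ else 0 := by
  have hmonomial (ψ : PureState d) : ketbra ψ i j = monomial (Pi.single i 1) (Pi.single j 1) ψ.1 *
      (((weightedNormSq 1 ψ.1 ^ (d + 1))⁻¹ : ℝ) : ℂ) := by
    rw [weightedNormSq_one_sphere ψ, one_pow, inv_one, Complex.ofReal_one, mul_one]
    simp only [monomial, Finset.prod_mul_distrib, Pi.single_apply, pow_ite, pow_one, pow_zero,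
      Finset.prod_ite_eq', Finset.mem_univ, if_true]
    rfl
  simp_rw [hmonomial]
  rw [integral_haarPure_monomial (w := 1) hd (fun _ => one_pos)
    (by simp [Finset.sum_add_distrib])]
  rcases eq_or_ne i j with rfl | h
  · have hprod : ∏ m, ((Pi.single i 1 : Fin d → ℕ) m).factorial = 1 :=
      Finset.prod_eq_one fun m _ => by rw [Pi.single_apply]; split_ifs <;> rfl
    have hfactorial : (d + 1 - 1).factorial = d * (d - 1).factorial := by
      rw [Nat.add_sub_cancel, Nat.mul_factorial_pred hd.ne']
    have : ((d - 1).factorial : ℂ) ≠ 0 := Nat.cast_ne_zero.2 (Nat.factorial_ne_zero _)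
    have : (d : ℂ) ≠ 0 := Nat.cast_ne_zero.2 hd.ne'
    simp only [if_true, Pi.one_apply, one_pow, div_one, hfactorial, ← Nat.cast_prod, hprod]
    push_cast
    field_simp
  · rw [Finset.prod_eq_zero (Finset.mem_univ i) (by simp [h]), mul_zero, if_neg h,
      Complex.ofReal_zero]

lemma frame_apply_self (hd : 0 < d) (hρ : ρ.IsHermitian) (hborn : ∀ ψ, born ρ ψ ≠ 0) :
    frame ρ ρ = 1 := by
  ext i j
  have hintegrand (ψ : PureState d) :
      ((((born ρ ψ)⁻¹ : ℝ) : ℂ) • dOuter (ketbra ψ) (ketbra ψ)) ρ i j = ketbra ψ i j := by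
    rw [LinearMap.smul_apply, dOuter_apply, (isHermitian_ketbra ψ).eq, ← ofReal_born hρ, smul_smul,
      ← Complex.ofReal_mul, inv_mul_cancel₀ (hborn ψ), Complex.ofReal_one, one_smul]
  rw [frame, LinearMap.smul_apply, Matrix.smul_apply,
    haarIntegral_apply (integrable_inv_born_smul_dOuter hd hborn)]
  simp_rw [hintegrand]
  rw [integral_ketbra_apply hd, Matrix.one_apply, smul_eq_mul, mul_ite, mul_zero,
    mul_inv_cancel₀ (Nat.cast_ne_zero.2 hd.ne')]

lemma trace_tracelessProj (X : Op d) : (tracelessProj d X).trace = 0 := by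
  rcases Nat.eq_zero_or_pos d with rfl | hd
  · exact Finset.sum_empty
  · have hd' : (d : ℂ) ≠ 0 := Nat.cast_ne_zero.2 hd.ne'
    rw [tracelessProj_apply, Matrix.trace_sub, Matrix.trace_smul, Matrix.trace_one,
      Fintype.card_fin, smul_eq_mul]
    field_simp
    ring

lemma frame_mul_add_dOuter_eq_one (hd : 0 < d) (hρ : ρ.IsHermitian) (htr : ρ.trace = 1)
    (hborn : ∀ ψ, born ρ ψ ≠ 0) {G : SuperOp d} (hG : tracelessProj d * G = G)
    (hFG : fisher ρ * G = tracelessProj d) : frame ρ * (G + dOuter ρ ρ) = 1 := by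
  refine LinearMap.ext fun X => ?_
  have hFρ : frame ρ ρ = 1 := frame_apply_self hd hρ hborn
  have hρF : (ρ * frame ρ (G X)).trace = 0 := by
    have h := trace_conjTranspose_mul_frame hd hborn ρ (G X)
    rw [hρ.eq, hFρ, Matrix.conjTranspose_one, one_mul] at h
    rw [h, ← hG, Module.End.mul_apply, trace_tracelessProj]
  have hproj : tracelessProj d (frame ρ (G X)) = tracelessProj d X := by
    rw [fisher, mul_assoc, hG] at hFG
    exact LinearMap.congr_fun hFG X
  rw [tracelessProj_apply, tracelessProj_apply] at hproj
  have hρX : (ρ * X).trace = (d : ℂ)⁻¹ * X.trace - (d : ℂ)⁻¹ * (frame ρ (G X)).trace := by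
    have h := congrArg (fun Y => (ρ * Y).trace) hproj
    simp only [Matrix.mul_sub, Matrix.mul_smul, mul_one, Matrix.trace_sub, Matrix.trace_smul, hρF,
      htr, smul_eq_mul] at h
    linear_combination -h
  have hFGX : frame ρ (G X) = X - (ρ * X).trace • 1 := by
    rw [hρX, sub_smul, ← sub_add, ← hproj, sub_add_cancel]
  rw [Module.End.mul_apply, LinearMap.add_apply, map_add, hFGX, dOuter_apply, map_smul, hFρ,
    hρ.eq, sub_add_cancel, Module.End.one_apply]

theorem blueMatrix_eq_of_fisher_mul_eq (hd : 0 < d) (hρ : ρ.IsHermitian) (htr : ρ.trace = 1)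
    (hborn : ∀ ψ, born ρ ψ ≠ 0) {G : SuperOp d} (hG : tracelessProj d * G = G)
    (hFG : fisher ρ * G = tracelessProj d) : blueMatrix ρ = G := by
  rw [blueMatrix_eq_sub_dOuter hd hborn (frame_mul_add_dOuter_eq_one hd hρ htr hborn hG hFG),
    add_sub_cancel_right]

end FrameInverse

/-! ### The states `ρ_r(s)` -/

section ReferenceParameters

variable {d r : ℕ} {s : ℝ}

lemma lam2_pos (hd : 0 < d) (hs1 : s < 1) : 0 < lam2 d s :=
  div_pos (sub_pos.2 hs1) (Nat.cast_pos.2 hd)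

lemma lam1_pos (hd : 0 < d) (hs0 : 0 ≤ s) (hs1 : s < 1) : 0 < lam1 d r s :=
  add_pos_of_nonneg_of_pos (by positivity) (lam2_pos hd hs1)

lemma mul_cos_sq_add_eq (hd : 0 < d) (hr : 0 < r) (s α : ℝ) :
    d * s * Real.cos α ^ 2 + r * (1 - s)
      = d * r * (Real.cos α ^ 2 * lam1 d r s + Real.sin α ^ 2 * lam2 d s) := by
  have : (d : ℝ) ≠ 0 := Nat.cast_ne_zero.2 hd.ne'
  have : (r : ℝ) ≠ 0 := Nat.cast_ne_zero.2 hr.ne'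
  rw [lam1, lam2, Real.sin_sq]
  field_simp
  ring

theorem g_eq_halfLineIntegral (hr : 0 < r) (hrd : r < d) (hs0 : 0 ≤ s) (hs1 : s < 1) {j k : ℕ}
    (hjk : j + k = 2) :
    g d r s j k = halfLineIntegral (lam1 d r s) (lam2 d s) (r + j) (d - r + k) := by
  have hd := hr.trans hrd
  have h₁ : 0 < lam1 d r s := lam1_pos hd hs0 hs1
  have h₂ : 0 < lam2 d s := lam2_pos hd hs1
  have hd' : (d : ℝ) ≠ 0 := Nat.cast_ne_zero.2 hd.ne'
  have hr' : (r : ℝ) ≠ 0 := Nat.cast_ne_zero.2 hr.ne'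
  obtain ⟨m, hm⟩ : ∃ m, r + j = m + 1 := ⟨r + j - 1, by omega⟩
  obtain ⟨n, hn⟩ : ∃ n, d - r + k = n + 1 := ⟨d - r + k - 1, by omega⟩
  have hGamma : Real.Gamma (r + j) = m.factorial := by
    rw [← Nat.cast_add, hm, Nat.cast_succ, Real.Gamma_nat_eq_factorial]
  have hGamma' : Real.Gamma ((d : ℝ) - r + k) = n.factorial := by
    rw [← Nat.cast_sub hrd.le, ← Nat.cast_add, hn, Nat.cast_succ, Real.Gamma_nat_eq_factorial]
  have hintegrand (α : ℝ) :
      Real.cos α ^ (2 * r - 1 + 2 * j) * Real.sin α ^ (2 * d - 2 * r - 1 + 2 * k) /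
          (d * s * Real.cos α ^ 2 + r * (1 - s))
        = (d * r : ℝ)⁻¹ * (Real.cos α ^ (2 * m + 1) * Real.sin α ^ (2 * n + 1) /
          (Real.cos α ^ 2 * lam1 d r s + Real.sin α ^ 2 * lam2 d s)) := by
    rw [mul_cos_sq_add_eq hd hr, show 2 * r - 1 + 2 * j = 2 * m + 1 by omega,
      show 2 * d - 2 * r - 1 + 2 * k = 2 * n + 1 by omega, mul_comm (d * r : ℝ), ← div_div,
      div_eq_inv_mul]
  simp_rw [g, hintegrand]
  rw [intervalIntegral.integral_const_mul, integral_cos_sin_div_eq_intervalIntegral h₁ h₂, hm, hn,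
    halfLineIntegral_eq_intervalIntegral h₁ h₂, hGamma, hGamma', Real.Gamma_nat_eq_factorial,
    show m + n = d by omega]
  generalize (∫ x in (0 : ℝ)..1,
    (x * lam1 d r s + (1 - x) * lam2 d s)⁻¹ * (x ^ m * (1 - x) ^ n)) = I
  field_simp

section Positivity

variable (hr : 0 < r) (hrd : r < d) (hs0 : 0 ≤ s) (hs1 : s < 1)
include hr hrd hs0 hs1

lemma g_pos {j k : ℕ} (hjk : j + k = 2) : 0 < g d r s j k := by
  have hd := hr.trans hrd
  rw [g_eq_halfLineIntegral hr hrd hs0 hs1 hjk]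
  exact halfLineIntegral_pos (lam1_pos hd hs0 hs1) (lam2_pos hd hs1) (by omega)

lemma two_mul_bPar_le : 2 * bPar d r s ≤ aPar d r s + cPar d r s := by
  have hd := hr.trans hrd
  rw [aPar, bPar, cPar, g_eq_halfLineIntegral hr hrd hs0 hs1 rfl,
    g_eq_halfLineIntegral hr hrd hs0 hs1 rfl, g_eq_halfLineIntegral hr hrd hs0 hs1 rfl]
  exact two_mul_halfLineIntegral_le (lam1_pos hd hs0 hs1) (lam2_pos hd hs1) r (d - r)

lemma betaPar_pos : 0 < betaPar d r s := by
  have ha : 0 < aPar d r s := g_pos hr hrd hs0 hs1 rfl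
  have hc : 0 < cPar d r s := g_pos hr hrd hs0 hs1 rfl
  have hr' : (0 : ℝ) < r := Nat.cast_pos.2 hr
  have hdr : (0 : ℝ) < d - r := sub_pos.2 (Nat.cast_lt.2 hrd)
  have hconvex : 0 ≤ r * ((d : ℝ) - r) * (aPar d r s + cPar d r s - 2 * bPar d r s) :=
    mul_nonneg (mul_pos hr' hdr).le (sub_nonneg.2 (two_mul_bPar_le hr hrd hs0 hs1))
  refine div_pos ?_ (Nat.cast_pos.2 (hr.trans hrd))
  calc 0 < ((d : ℝ) - r) * aPar d r s + r * cPar d r s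
        + r * ((d : ℝ) - r) * (aPar d r s + cPar d r s - 2 * bPar d r s) := by positivity
    _ = _ := by ring

end Positivity

/-- The eigenvalues `a`, `b`, `c`, `β` of the Fisher superoperator of `ρ_r(s)`. -/
def fisherEigenvalues (d r : ℕ) (s : ℝ) : Fin 4 → ℝ :=
  ![aPar d r s, bPar d r s, cPar d r s, betaPar d r s]

lemma fisherEigenvalues_pos (hr : 0 < r) (hrd : r < d) (hs0 : 0 ≤ s) (hs1 : s < 1) (i : Fin 4) :
    0 < fisherEigenvalues d r s i := by
  fin_cases i
  · exact g_pos hr hrd hs0 hs1 rfl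
  · exact g_pos hr hrd hs0 hs1 rfl
  · exact g_pos hr hrd hs0 hs1 rfl
  · exact betaPar_pos hr hrd hs0 hs1

lemma blockVal_eq (i j : Fin d) : blockVal d r s i j
    = ![![aPar d r s, bPar d r s], ![bPar d r s, cPar d r s]]
        (blockIndex d r i) (blockIndex d r j) := by
  unfold blockVal blockIndex
  split_ifs <;> first | rfl | omega

lemma blockVal_comm (i j : Fin d) : blockVal d r s i j = blockVal d r s j i := by
  unfold blockVal
  split_ifs <;> first | rfl | omega

lemma Mmat_apply (i j : Fin d) :
    Mmat d r s i j = (1 + if i = j then 1 else 0) * blockVal d r s i j := rfl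

lemma isSymm_Mmat : (Mmat d r s).IsSymm := by
  ext i j
  rw [Matrix.transpose_apply, Mmat_apply, Mmat_apply, blockVal_comm j i]
  simp only [eq_comm]

end ReferenceParameters

section ReferenceState

variable {d r : ℕ} {s : ℝ}

/-- The eigenvalue of `ρ_r(s)` belonging to the `m`-th basis vector. -/
def rhoEigenvalue (d r : ℕ) (s : ℝ) (m : Fin d) : ℝ := ![lam1 d r s, lam2 d s] (blockIndex d r m)

lemma rhoEigenvalue_pos (hs0 : 0 ≤ s) (hs1 : s < 1) (m : Fin d) : 0 < rhoEigenvalue d r s m := by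
  have hd : 0 < d := m.pos
  unfold rhoEigenvalue blockIndex
  split_ifs
  · exact lam1_pos hd hs0 hs1
  · exact lam2_pos hd hs1

lemma rhoState_eq_diagonal (d r : ℕ) (s : ℝ) :
    rhoState d r s = Matrix.diagonal fun m => (rhoEigenvalue d r s m : ℂ) := by
  ext i j
  have hblock : (∑ m : Fin d with m.val < r, E m m) i j
      = if i = j ∧ i.val < r then (1 : ℂ) else 0 := by
    rw [Matrix.sum_apply, Finset.sum_filter, Finset.sum_eq_single i]
    · by_cases hij : i = j <;> by_cases hi : i.val < r <;> simp [E, hij, hi]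
    · exact fun m _ hm => by simp [E, hm]
    · simp
  rw [rhoState, Matrix.add_apply, Matrix.smul_apply, Matrix.smul_apply, hblock,
    Matrix.diagonal_apply, Matrix.one_apply, rhoEigenvalue, blockIndex]
  rcases eq_or_ne i j with rfl | hij
  · by_cases hi : i.val < r <;> simp [hi, lam1, lam2]
  · simp [hij]

lemma sum_rhoEigenvalue (hr : 0 < r) (hrd : r < d) (s : ℝ) : ∑ m, rhoEigenvalue d r s m = 1 := by
  have : (d : ℝ) ≠ 0 := Nat.cast_ne_zero.2 (hr.trans hrd).ne'
  have : (r : ℝ) ≠ 0 := Nat.cast_ne_zero.2 hr.ne'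
  unfold rhoEigenvalue
  rw [sum_comp_eq_sum_fiberCard, Fin.sum_univ_two, fiberCard_blockIndex_zero hrd.le,
    fiberCard_blockIndex_one hrd.le, Nat.cast_sub hrd.le, Matrix.cons_val_zero, Matrix.cons_val_one,
    Matrix.cons_val_fin_one, lam1, lam2]
  field_simp
  ring

lemma isHermitian_rhoState : (rhoState d r s).IsHermitian := by
  rw [rhoState_eq_diagonal]
  exact isHermitian_diagonal_ofReal _

lemma trace_rhoState (hr : 0 < r) (hrd : r < d) : (rhoState d r s).trace = 1 := by
  rw [rhoState_eq_diagonal, Matrix.trace_diagonal, ← Complex.ofReal_sum, sum_rhoEigenvalue hr hrd,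
    Complex.ofReal_one]

lemma born_rhoState_ne_zero (hs0 : 0 ≤ s) (hs1 : s < 1) (ψ : PureState d) :
    born (rhoState d r s) ψ ≠ 0 := by
  rw [rhoState_eq_diagonal]
  exact born_diagonal_ne_zero (rhoEigenvalue_pos hs0 hs1) ψ

lemma prod_one_add_mul_rhoEigenvalue (hrd : r ≤ d) (s z : ℝ) :
    ∏ m, (1 + z * rhoEigenvalue d r s m)
      = (1 + z * lam1 d r s) ^ r * (1 + z * lam2 d s) ^ (d - r) := by
  have hfiber : ∏ m, (1 + z * rhoEigenvalue d r s m)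
      = ∏ c, (1 + z * ![lam1 d r s, lam2 d s] c) ^ fiberCard (blockIndex d r) c := by
    simp_rw [fiberCard, ← Finset.prod_const]
    exact (Finset.prod_fiberwise' _ _ fun c => 1 + z * ![lam1 d r s, lam2 d s] c).symm
  rw [hfiber, Fin.prod_univ_two, fiberCard_blockIndex_zero hrd, fiberCard_blockIndex_one hrd]
  rfl

lemma frameValue_rhoEigenvalue (hr : 0 < r) (hrd : r < d) (hs0 : 0 ≤ s) (hs1 : s < 1)
    (i j : Fin d) : frameValue (rhoEigenvalue d r s) i j = blockVal d r s i j := by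
  have hg (j k : ℕ) := g_eq_halfLineIntegral (j := j) (k := k) hr hrd hs0 hs1
  simp_rw [frameValue, prod_one_add_mul_rhoEigenvalue hrd.le, blockVal_eq, aPar, bPar, cPar,
    hg 2 0 rfl, hg 1 1 rfl, hg 0 2 rfl, halfLineIntegral, rhoEigenvalue]
  generalize blockIndex d r i = c
  generalize blockIndex d r j = c'
  fin_cases c <;> fin_cases c' <;>
    exact integral_congr_ae (.of_forall fun z => congrArg Inv.inv (by dsimp; ring))

theorem frame_rhoState (hr : 0 < r) (hrd : r < d) (hs0 : 0 ≤ s) (hs1 : s < 1) :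
    frame (rhoState d r s) = schurSuper (blockVal d r s) (Mmat d r s) := by
  have hvalue : frameValue (rhoEigenvalue d r s) = blockVal d r s :=
    funext₂ (frameValue_rhoEigenvalue hr hrd hs0 hs1)
  rw [rhoState_eq_diagonal, frame_diagonal (rhoEigenvalue_pos hs0 hs1) (hr.trans hrd), hvalue, Mmat]

end ReferenceState

section Fisher

variable {d r : ℕ} {s : ℝ}

lemma Ibar_eq_one_sub_fiberMean : Ibar d = 1 - fiberMean ℝ fun _ : Fin d => () := by
  ext i j
  simp [Ibar, fiberMean_unit_apply]

lemma Ibar_mul_mul_Ibar_apply (M : Matrix (Fin d) (Fin d) ℝ) (i j : Fin d) :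
    (Ibar d * M * Ibar d) i j = M i j - (d : ℝ)⁻¹ * ∑ k, M k j - (d : ℝ)⁻¹ * ∑ l, M i l
      + (d : ℝ)⁻¹ ^ 2 * ∑ k, ∑ l, M k l := by
  have hleft (l : Fin d) : (Ibar d * M) i l = M i l - (d : ℝ)⁻¹ * ∑ k, M k l := by
    rw [Ibar, sub_mul, one_mul, Matrix.smul_mul]
    simp [Matrix.mul_apply]
  have hright : (Ibar d * M * Ibar d) i j
      = (Ibar d * M) i j - (d : ℝ)⁻¹ * ∑ l, (Ibar d * M) i l := by
    generalize Ibar d * M = N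
    rw [Ibar, mul_sub, mul_one, Matrix.mul_smul]
    simp [Matrix.mul_apply]
  rw [hright, hleft]
  simp only [hleft, Finset.sum_sub_distrib, ← Finset.mul_sum]
  rw [Finset.sum_comm]
  ring

lemma sum_Mmat (hrd : r < d) (i : Fin d) : ∑ j, Mmat d r s i j
    = ![((r : ℝ) + 1) * aPar d r s + (d - r) * bPar d r s,
        r * bPar d r s + (d - r + 1) * cPar d r s] (blockIndex d r i) := by
  simp only [Mmat_apply, blockVal_eq, add_mul, one_mul, ite_mul, zero_mul, Finset.sum_add_distrib,
    Finset.sum_ite_eq, Finset.mem_univ, if_true]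
  rw [sum_comp_eq_sum_fiberCard (blockIndex d r), Fin.sum_univ_two,
    fiberCard_blockIndex_zero hrd.le, fiberCard_blockIndex_one hrd.le, Nat.cast_sub hrd.le]
  generalize blockIndex d r i = c
  fin_cases c <;> dsimp <;> ring

lemma Mbar_eq_spectralMatrix (hr : 0 < r) (hrd : r < d) (s : ℝ) :
    Mbar d r s
      = spectralMatrix (blockIndex d r) ![aPar d r s, cPar d r s] (betaPar d r s) 0 := by
  have hd : (d : ℝ) ≠ 0 := Nat.cast_ne_zero.2 (hr.trans hrd).ne'
  have hr0 : (r : ℝ) ≠ 0 := Nat.cast_ne_zero.2 hr.ne'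
  have hdr : (d : ℝ) - r ≠ 0 := sub_ne_zero.2 (Nat.cast_lt.2 hrd).ne'
  have hcol (j : Fin d) : ∑ k, Mmat d r s k j = ∑ k, Mmat d r s j k :=
    Finset.sum_congr rfl fun k _ => isSymm_Mmat.apply j k
  ext i j
  rw [Mbar, Ibar_mul_mul_Ibar_apply, hcol]
  simp only [sum_Mmat hrd]
  rw [sum_comp_eq_sum_fiberCard (blockIndex d r)]
  simp only [spectralMatrix_apply, Fintype.card_fin, Fin.sum_univ_two, Mmat_apply, blockVal_eq,
    betaPar, fiberCard_blockIndex_zero hrd.le, fiberCard_blockIndex_one hrd.le]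
  rcases eq_or_ne i j with rfl | hij
  · generalize blockIndex d r i = c
    fin_cases c <;>
      simp only [Fin.zero_eta, Fin.mk_one, Matrix.cons_val, ↓reduceIte, Nat.cast_sub hrd.le,
        fiberCard_blockIndex_zero hrd.le, fiberCard_blockIndex_one hrd.le] <;>
      field_simp <;> ring
  · simp only [if_neg hij]
    generalize blockIndex d r i = c
    generalize blockIndex d r j = c'
    fin_cases c <;> fin_cases c' <;>
      simp only [Fin.zero_eta, Fin.mk_one, Matrix.cons_val, ↓reduceIte, zero_ne_one, one_ne_zero,
        Nat.cast_sub hrd.le, fiberCard_blockIndex_zero hrd.le, fiberCard_blockIndex_one hrd.le] <;>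
      field_simp <;> ring

lemma fisher_rhoState (hr : 0 < r) (hrd : r < d) (hs0 : 0 ≤ s) (hs1 : s < 1) :
    fisher (rhoState d r s) = schurSuper (blockVal d r s) (Mbar d r s) := by
  rw [fisher, frame_rhoState hr hrd hs0 hs1, tracelessProj_eq_schurSuper,
    ← Ibar_eq_one_sub_fiberMean, schurSuper_mul, schurSuper_mul, Mbar]
  simp only [one_mul, mul_one]

theorem fisher_rhoState_eq_spectralSuper (hr : 0 < r) (hrd : r < d) (hs0 : 0 ≤ s) (hs1 : s < 1) :
    fisher (rhoState d r s) = spectralSuper d r (fisherEigenvalues d r s) := by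
  rw [fisher_rhoState hr hrd hs0 hs1, Mbar_eq_spectralMatrix hr hrd]
  refine schurSuper_congr (fun i j _ => blockVal_eq i j) ?_
  congr 1
  ext c
  fin_cases c <;> rfl

lemma fisher_rhoState_mul_spectralSuper_inv (hr : 0 < r) (hrd : r < d) (hs0 : 0 ≤ s)
    (hs1 : s < 1) :
    fisher (rhoState d r s) * spectralSuper d r (fisherEigenvalues d r s)⁻¹ = tracelessProj d := by
  have hx : fisherEigenvalues d r s * (fisherEigenvalues d r s)⁻¹ = 1 :=
    funext fun i => mul_inv_cancel₀ (fisherEigenvalues_pos hr hrd hs0 hs1 i).ne'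
  rw [fisher_rhoState_eq_spectralSuper hr hrd hs0 hs1, spectralSuper_mul, hx, spectralSuper_one]

lemma tracelessProj_mul_spectralSuper (x : Fin 4 → ℝ) :
    tracelessProj d * spectralSuper d r x = spectralSuper d r x := by
  rw [← spectralSuper_one d r, spectralSuper_mul, one_mul]

theorem isUnit_frame_rhoState (hr : 0 < r) (hrd : r < d) (hs0 : 0 ≤ s) (hs1 : s < 1) :
    IsUnit (frame (rhoState d r s)) :=
  IsUnit.of_mul_eq_one _ <| frame_mul_add_dOuter_eq_one (hr.trans hrd) isHermitian_rhoState
    (trace_rhoState hr hrd) (born_rhoState_ne_zero hs0 hs1) (tracelessProj_mul_spectralSuper _)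
    (fisher_rhoState_mul_spectralSuper_inv hr hrd hs0 hs1)

theorem blueMatrix_rhoState (hr : 0 < r) (hrd : r < d) (hs0 : 0 ≤ s) (hs1 : s < 1) :
    blueMatrix (rhoState d r s) = spectralSuper d r (fisherEigenvalues d r s)⁻¹ :=
  blueMatrix_eq_of_fisher_mul_eq (hr.trans hrd) isHermitian_rhoState (trace_rhoState hr hrd)
    (born_rhoState_ne_zero hs0 hs1) (tracelessProj_mul_spectralSuper _)
    (fisher_rhoState_mul_spectralSuper_inv hr hrd hs0 hs1)

end Fisher

section BlockProjectors

variable {d r : ℕ}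

lemma sum_ite_dOuter_apply (p : Fin d → Fin d → Prop) [∀ j k, Decidable (p j k)] (X : Op d)
    (i l : Fin d) :
    (∑ j : Fin d, ∑ k : Fin d, if p j k then dOuter (E j k) (E j k) else 0 : SuperOp d) X i l
      = if p i l then X i l else 0 := by
  have hterm (j k : Fin d) : ((if p j k then dOuter (E j k) (E j k) else 0 : SuperOp d) X) i l
      = if j = i then (if k = l then (if p i l then X i l else 0) else 0) else 0 := by
    by_cases hp : p j k
    · rw [if_pos hp, dOuter_apply, trace_E_conjTranspose_mul, Matrix.smul_apply, E,
        Matrix.single_apply]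
      rcases eq_or_ne j i with rfl | hj
      · rcases eq_or_ne k l with rfl | hk <;> simp [*]
      · simp [hj]
    · rw [if_neg hp]
      rcases eq_or_ne j i with rfl | hj
      · rcases eq_or_ne k l with rfl | hk <;> simp [*]
      · simp [hj]
  simp only [LinearMap.sum_apply, Matrix.sum_apply, hterm]
  simp

lemma P1_apply (X : Op d) (i j : Fin d) :
    P1 d r X i j = if i ≠ j ∧ i.val < r ∧ j.val < r then X i j else 0 :=
  sum_ite_dOuter_apply _ X i j

lemma P3_apply (X : Op d) (i j : Fin d) :
    P3 d r X i j = if i ≠ j ∧ r ≤ i.val ∧ r ≤ j.val then X i j else 0 :=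
  sum_ite_dOuter_apply _ X i j

lemma P2_apply (X : Op d) (i j : Fin d) :
    P2 d r X i j = (if i.val < r ∧ r ≤ j.val then X i j else 0)
      + if j.val < r ∧ r ≤ i.val then X i j else 0 := by
  have hP2 : P2 d r = (∑ j : Fin d, ∑ k : Fin d,
        if j.val < r ∧ r ≤ k.val then dOuter (E j k) (E j k) else 0)
      + ∑ j : Fin d, ∑ k : Fin d,
        if k.val < r ∧ r ≤ j.val then dOuter (E j k) (E j k) else 0 := by
    rw [Finset.sum_comm (f := fun j k : Fin d =>
      if k.val < r ∧ r ≤ j.val then dOuter (E j k) (E j k) else 0), P2]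
    simp_rw [← Finset.sum_add_distrib, ite_add_ite, add_zero]
  rw [hP2, LinearMap.add_apply, Matrix.add_apply, sum_ite_dOuter_apply, sum_ite_dOuter_apply]

lemma diagSuper_apply (N : Matrix (Fin d) (Fin d) ℝ) (X : Op d) (i j : Fin d) :
    diagSuper N X i j = if i = j then ∑ k, ((N i k : ℝ) : ℂ) * X k k else 0 := by
  simp only [diagSuper, LinearMap.sum_apply, LinearMap.smul_apply, dOuter_apply,
    trace_E_conjTranspose_mul, Matrix.sum_apply, Matrix.smul_apply, smul_eq_mul]
  rcases eq_or_ne i j with rfl | h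
  · rw [if_pos rfl, Finset.sum_eq_single i (fun m _ hm => by simp [E, hm]) (by simp)]
    simp [E]
  · rw [if_neg h]
    refine Finset.sum_eq_zero fun m _ => Finset.sum_eq_zero fun k _ => ?_
    have hm : ¬(m = i ∧ m = j) := fun hm => h (hm.1.symm.trans hm.2)
    simp [E, hm]

theorem schurSuper_blockVal_eq (s : ℝ) (N : Matrix (Fin d) (Fin d) ℝ) :
    schurSuper (blockVal d r s) N = ((aPar d r s : ℝ) : ℂ) • P1 d r
      + ((bPar d r s : ℝ) : ℂ) • P2 d r + ((cPar d r s : ℝ) : ℂ) • P3 d r + diagSuper N := by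
  refine LinearMap.ext fun X => ?_
  ext i j
  simp only [LinearMap.add_apply, LinearMap.smul_apply, Matrix.add_apply, Matrix.smul_apply,
    P1_apply, P2_apply, P3_apply, diagSuper_apply, smul_eq_mul]
  rcases eq_or_ne i j with rfl | hij
  · have hi : ¬(i.val < r ∧ r ≤ i.val) := fun h => h.1.not_ge h.2
    simp [schurSuper_apply_self, hi]
  · rw [schurSuper_apply_of_ne _ hij, blockVal]
    by_cases hi : i.val < r <;> by_cases hj : j.val < r <;>
      simp [hij, hi, hj, not_lt.1, not_le.2]

end BlockProjectors

section Spectrum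

variable {d r : ℕ} {s : ℝ}

lemma isSymm_Mbar (hr : 0 < r) (hrd : r < d) (s : ℝ) : (Mbar d r s).IsSymm := by
  rw [Mbar_eq_spectralMatrix hr hrd]
  exact isSymm_spectralMatrix _ _ _ _

theorem charpoly_Mbar (hr : 0 < r) (hrd : r < d) (s : ℝ) :
    (Mbar d r s).charpoly = Polynomial.X * (Polynomial.X - Polynomial.C (aPar d r s)) ^ (r - 1)
      * (Polynomial.X - Polynomial.C (cPar d r s)) ^ (d - r - 1)
      * (Polynomial.X - Polynomial.C (betaPar d r s)) := by
  have : Nonempty (Fin d) := ⟨⟨r, hrd⟩⟩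
  rw [Mbar_eq_spectralMatrix hr hrd, charpoly_spectralMatrix (surjective_blockIndex hr hrd),
    Fin.prod_univ_two, fiberCard_blockIndex_zero hrd.le, fiberCard_blockIndex_one hrd.le,
    Fintype.card_fin, map_zero, sub_zero, pow_one]
  simp only [Matrix.cons_val_zero, Matrix.cons_val_one]
  ring

theorem charpoly_restrictTH_fisher_rhoState (hr : 0 < r) (hrd : r < d) (hs0 : 0 ≤ s)
    (hs1 : s < 1) :
    (restrictTH (fisher (rhoState d r s))).charpoly
      = (Polynomial.X - Polynomial.C (aPar d r s)) ^ (r ^ 2 - 1)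
        * (Polynomial.X - Polynomial.C (bPar d r s)) ^ (2 * r * (d - r))
        * (Polynomial.X - Polynomial.C (cPar d r s)) ^ ((d - r) ^ 2 - 1)
        * (Polynomial.X - Polynomial.C (betaPar d r s)) := by
  rw [fisher_rhoState_eq_spectralSuper hr hrd hs0 hs1,
    charpoly_restrictTH_spectralSuper hr hrd, prod_pow_spectralMultiplicity]
  rfl

end Spectrum

/-! ### Mean-square errors and the uncertainty ellipsoid -/

section BuresWeight

variable {d : ℕ} (l : Fin d → ℝ)

lemma mulLeft_add_mulRight_diagonal :
    LinearMap.mulLeft ℂ (Matrix.diagonal fun i => (l i : ℂ))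
        + LinearMap.mulRight ℂ (Matrix.diagonal fun i => (l i : ℂ))
      = schurSuper (fun i j => l i + l j) (Matrix.diagonal fun i => l i + l i) := by
  refine LinearMap.ext fun X => ?_
  ext i j
  rw [LinearMap.add_apply, LinearMap.mulLeft_apply, LinearMap.mulRight_apply, Matrix.add_apply,
    Matrix.diagonal_mul, Matrix.mul_diagonal, mul_comm (X i j), ← add_mul, ← Complex.ofReal_add]
  rcases eq_or_ne i j with rfl | hij
  · rw [schurSuper_apply_self, Finset.sum_eq_single i
      (fun k _ hk => by rw [Matrix.diagonal_apply_ne _ hk.symm, Complex.ofReal_zero, zero_mul])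
      (by simp), Matrix.diagonal_apply_eq]
  · rw [schurSuper_apply_of_ne _ hij]

variable {l}

lemma buresWeight_diagonal (hl : ∀ i, 0 < l i) :
    buresWeight (Matrix.diagonal fun i => (l i : ℂ)) = (1 / 2 : ℂ) • schurSuper
      (fun i j => (l i + l j)⁻¹) (Matrix.diagonal fun i => (l i + l i)⁻¹) := by
  have hmul : schurSuper (fun i j => l i + l j) (Matrix.diagonal fun i => l i + l i)
      * schurSuper (fun i j => (l i + l j)⁻¹) (Matrix.diagonal fun i => (l i + l i)⁻¹) = 1 := by
    rw [schurSuper_mul, Matrix.diagonal_mul_diagonal]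
    simp_rw [mul_inv_cancel₀ (add_pos (hl _) (hl _)).ne']
    exact (schurSuper_scalar 1).trans (map_one _)
  rw [buresWeight, mulLeft_add_mulRight_diagonal]
  congr 1
  exact Ring.inverse_unit ⟨_, _, hmul, mul_eq_one_comm.1 hmul⟩

end BuresWeight

section Estimation

variable {d r : ℕ} {s : ℝ}

theorem scaledMSE_rhoState (hr : 0 < r) (hrd : r < d) (hs0 : 0 ≤ s) (hs1 : s < 1) :
    scaledMSE (rhoState d r s) =
      ((r : ℝ) ^ 2 - 1) / aPar d r s + 2 * r * ((d : ℝ) - r) / bPar d r s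
        + (((d : ℝ) - r) ^ 2 - 1) / cPar d r s + 1 / betaPar d r s := by
  rw [scaledMSE, scaledWMSE, one_mul, blueMatrix_rhoState hr hrd hs0 hs1,
    trace_spectralSuper hr hrd]
  simp only [div_eq_mul_inv, one_mul]
  rfl

lemma buresWeight_rhoState (hs0 : 0 ≤ s) (hs1 : s < 1) :
    buresWeight (rhoState d r s) = (1 / 2 : ℂ) • schurSuper
      (fun i j => (rhoEigenvalue d r s i + rhoEigenvalue d r s j)⁻¹)
      (Matrix.diagonal fun i => (rhoEigenvalue d r s i + rhoEigenvalue d r s i)⁻¹) := by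
  rw [rhoState_eq_diagonal, buresWeight_diagonal (rhoEigenvalue_pos hs0 hs1)]

theorem scaledMSB_rhoState (hr : 0 < r) (hrd : r < d) (hs0 : 0 ≤ s) (hs1 : s < 1) :
    scaledMSB (rhoState d r s) =
      (1 / 4) * (((r : ℝ) ^ 2 - 1) / (aPar d r s * lam1 d r s)
        + 4 * r * ((d : ℝ) - r) / (bPar d r s * (lam1 d r s + lam2 d s))
        + (((d : ℝ) - r) ^ 2 - 1) / (cPar d r s * lam2 d s)
        + ((d : ℝ) - r) / (d * betaPar d r s * lam1 d r s)
        + r / (d * betaPar d r s * lam2 d s)) := by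
  let l : Fin 2 → ℝ := ![lam1 d r s, lam2 d s]
  have htrace := trace_schurSuper_diagonal_mul_spectralSuper hr hrd
    (U := fun c c' => (l c + l c')⁻¹) (congrArg Inv.inv (add_comm _ _)) (fisherEigenvalues d r s)⁻¹
  have hre (t : ℂ) : ((1 / 2 : ℂ) * t).re = 1 / 2 * t.re := by simp
  rw [scaledMSB, scaledWMSE, blueMatrix_rhoState hr hrd hs0 hs1, buresWeight_rhoState hs0 hs1,
    smul_mul_assoc, map_smul, smul_eq_mul, hre]
  refine (congrArg (1 / 2 * ·) htrace).trans ?_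
  change 1 / 2 * (((r : ℝ) ^ 2 - 1) * ((lam1 d r s + lam1 d r s)⁻¹ * (aPar d r s)⁻¹)
    + 2 * r * ((d : ℝ) - r) * ((lam1 d r s + lam2 d s)⁻¹ * (bPar d r s)⁻¹)
    + (((d : ℝ) - r) ^ 2 - 1) * ((lam2 d s + lam2 d s)⁻¹ * (cPar d r s)⁻¹)
    + (((d : ℝ) - r) / d * (lam1 d r s + lam1 d r s)⁻¹
      + r / d * (lam2 d s + lam2 d s)⁻¹) * (betaPar d r s)⁻¹) = _
  simp only [← two_mul, div_eq_mul_inv, mul_inv]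
  ring

lemma ellipsoidVol_rhoState_eq_prod (hr : 0 < r) (hrd : r < d) (hs0 : 0 ≤ s) (hs1 : s < 1) :
    ellipsoidVol (rhoState d r s)
      = ballVol d * (∏ i, fisherEigenvalues d r s i ^ spectralMultiplicity d r i)
        ^ (-(1 / 2) : ℝ) := by
  have hpos (i : Fin 4) := fisherEigenvalues_pos hr hrd hs0 hs1 i
  rw [ellipsoidVol, blueMatrix_rhoState hr hrd hs0 hs1, det_restrictTH_spectralSuper hr hrd,
    Real.rpow_neg (Finset.prod_nonneg fun i _ => (pow_pos (hpos i) _).le), ← Real.sqrt_eq_rpow,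
    ← Real.sqrt_inv, ← Finset.prod_inv_distrib]
  simp only [Pi.inv_apply, inv_pow]

theorem ellipsoidVol_rhoState (hr : 0 < r) (hrd : r < d) (hs0 : 0 ≤ s) (hs1 : s < 1) :
    ellipsoidVol (rhoState d r s)
      = ballVol d * (aPar d r s ^ (r ^ 2 - 1) * bPar d r s ^ (2 * r * (d - r))
        * cPar d r s ^ ((d - r) ^ 2 - 1) * betaPar d r s) ^ (-(1 / 2) : ℝ) := by
  rw [ellipsoidVol_rhoState_eq_prod hr hrd hs0 hs1, prod_pow_spectralMultiplicity]
  rfl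

lemma ballVol_pos (d : ℕ) : 0 < ballVol d :=
  div_pos (Real.rpow_pos_of_pos Real.pi_pos _) (Real.Gamma_pos_of_pos (by positivity))

theorem log_ellipsoidVol_rhoState (hr : 0 < r) (hrd : r < d) (hs0 : 0 ≤ s) (hs1 : s < 1) :
    Real.log (ellipsoidVol (rhoState d r s))
      = Real.log (ballVol d) - (1 / 2) * (((r : ℝ) ^ 2 - 1) * Real.log (aPar d r s)
        + 2 * r * ((d : ℝ) - r) * Real.log (bPar d r s)
        + (((d : ℝ) - r) ^ 2 - 1) * Real.log (cPar d r s)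
        + Real.log (betaPar d r s)) := by
  have hpos (i : Fin 4) : 0 < fisherEigenvalues d r s i ^ spectralMultiplicity d r i :=
    pow_pos (fisherEigenvalues_pos hr hrd hs0 hs1 i) _
  have hprod := Finset.prod_pos fun i (_ : i ∈ Finset.univ) => hpos i
  rw [ellipsoidVol_rhoState_eq_prod hr hrd hs0 hs1,
    Real.log_mul (ballVol_pos d).ne' (Real.rpow_pos_of_pos hprod _).ne', Real.log_rpow hprod,
    Real.log_prod fun i _ => (hpos i).ne']
  simp only [Real.log_pow, sum_spectralMultiplicity_mul hr hrd, neg_mul]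
  rfl

end Estimation

section Limit

variable {d r : ℕ}

lemma tendsto_lam1 : Tendsto (fun s => lam1 d r s) (𝓝[<] 1) (𝓝 (r : ℝ)⁻¹) := by
  have hcont : Continuous fun s : ℝ => lam1 d r s := by unfold lam1; fun_prop
  simpa [lam1] using (hcont.tendsto 1).mono_left nhdsWithin_le_nhds

lemma tendsto_lam2 : Tendsto (fun s => lam2 d s) (𝓝[<] 1) (𝓝 0) := by
  have hcont : Continuous fun s : ℝ => lam2 d s := by unfold lam2; fun_prop
  simpa [lam2] using (hcont.tendsto 1).mono_left nhdsWithin_le_nhds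

lemma eventually_nonneg_and_lt_one : ∀ᶠ s : ℝ in 𝓝[<] 1, 0 ≤ s ∧ s < 1 :=
  (eventually_nhdsWithin_of_eventually_nhds (lt_mem_nhds zero_lt_one)).mono (fun _ => le_of_lt)
    |>.and self_mem_nhdsWithin

lemma tendsto_g (hr : 0 < r) (hrd : r < d) {j k : ℕ} (hjk : j + k = 2) (hrj : 2 ≤ r + j) :
    Tendsto (fun s => g d r s j k) (𝓝[<] 1) (𝓝 ((r : ℝ) / (r + j - 1))) := by
  have hlim := tendsto_halfLineIntegral (inv_pos.2 (Nat.cast_pos.2 hr))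
    (tendsto_lam1 (d := d)) tendsto_lam2
    (eventually_nonneg_and_lt_one.mono fun s hs => (lam2_pos (hr.trans hrd) hs.2).le)
    (r + j - 2) (d - r + k)
  have hvalue : (((r + j - 2 : ℕ) + 1 : ℝ) * (r : ℝ)⁻¹)⁻¹ = (r : ℝ) / (r + j - 1) := by
    rw [Nat.cast_sub hrj, mul_inv, inv_inv, mul_comm, ← div_eq_mul_inv]
    push_cast
    ring
  rw [Nat.sub_add_cancel hrj, hvalue] at hlim
  exact hlim.congr' <| eventually_nonneg_and_lt_one.mono fun s hs =>
    (g_eq_halfLineIntegral hr hrd hs.1 hs.2 hjk).symm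

theorem tendsto_aPar (hr : 0 < r) (hrd : r < d) :
    Tendsto (fun s => aPar d r s) (𝓝[<] 1) (𝓝 ((r : ℝ) / (r + 1))) := by
  unfold aPar
  convert tendsto_g hr hrd (j := 2) (k := 0) rfl (by omega) using 3
  push_cast
  ring

theorem tendsto_bPar (hr : 0 < r) (hrd : r < d) :
    Tendsto (fun s => bPar d r s) (𝓝[<] 1) (𝓝 1) := by
  unfold bPar
  convert tendsto_g hr hrd (j := 1) (k := 1) rfl (by omega) using 2
  rw [Nat.cast_one, add_sub_cancel_right, div_self (Nat.cast_ne_zero.2 hr.ne')]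

theorem tendsto_cPar (hr : 2 ≤ r) (hrd : r < d) :
    Tendsto (fun s => cPar d r s) (𝓝[<] 1) (𝓝 ((r : ℝ) / (r - 1))) := by
  unfold cPar
  convert tendsto_g (two_pos.trans_le hr) hrd (j := 0) (k := 2) rfl hr using 3
  rw [Nat.cast_zero, add_zero]

lemma tendsto_betaPar (hr : 2 ≤ r) (hrd : r < d) :
    Tendsto (fun s => betaPar d r s) (𝓝[<] 1) (𝓝 ((r : ℝ) / (r - 1))) := by
  have hr0 : 0 < r := two_pos.trans_le hr
  have hd : (d : ℝ) ≠ 0 := Nat.cast_ne_zero.2 (hr0.trans hrd).ne'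
  have hr1 : (r : ℝ) - 1 ≠ 0 := sub_ne_zero.2 (Nat.one_lt_cast.2 hr).ne'
  have hlim := ((((tendsto_aPar hr0 hrd).const_mul ((r + 1) * ((d : ℝ) - r))).add
    ((tendsto_cPar hr hrd).const_mul (r * ((d : ℝ) - r + 1)))).sub
      ((tendsto_bPar hr0 hrd).const_mul (2 * r * ((d : ℝ) - r)))).div_const (d : ℝ)
  unfold betaPar
  convert hlim using 2
  field_simp
  ring

theorem tendsto_scaledMSE (hr : 2 ≤ r) (hrd : r < d) :
    Tendsto (fun s => scaledMSE (rhoState d r s)) (𝓝[<] 1)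
      (𝓝 ((d : ℝ) ^ 2 + 2 * d - 1 - (d : ℝ) ^ 2 / r - 1 / r)) := by
  have hr0 : 0 < r := two_pos.trans_le hr
  have hr' : (r : ℝ) ≠ 0 := Nat.cast_ne_zero.2 hr0.ne'
  have hr1 : (r : ℝ) - 1 ≠ 0 := sub_ne_zero.2 (Nat.one_lt_cast.2 hr).ne'
  have hlim := ((((tendsto_const_nhds (x := (r : ℝ) ^ 2 - 1)).div (tendsto_aPar hr0 hrd)
      (by positivity)).add
    ((tendsto_const_nhds (x := 2 * r * ((d : ℝ) - r))).div (tendsto_bPar hr0 hrd) one_ne_zero)).add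
    ((tendsto_const_nhds (x := ((d : ℝ) - r) ^ 2 - 1)).div (tendsto_cPar hr hrd)
      (by positivity))).add
    ((tendsto_const_nhds (x := (1 : ℝ))).div (tendsto_betaPar hr hrd) (by positivity))
  have hMSE := hlim.congr' <| eventually_nonneg_and_lt_one.mono fun s hs =>
    (scaledMSE_rhoState hr0 hrd hs.1 hs.2).symm
  convert hMSE using 2
  field_simp
  ring

end Limit

end CovTomo

end

open CovTomo in
theorem mainTheorem5 (d r : ℕ) (hr : 1 ≤ r) (hrd : r < d) :
    (∀ s : ℝ, 0 ≤ s → s < 1 →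
      -- the parameters are positive and the measurement is informationally complete
      (0 < aPar d r s ∧ 0 < bPar d r s ∧ 0 < cPar d r s ∧ 0 < betaPar d r s) ∧
      IsUnit (frame (rhoState d r s)) ∧
      -- the frame superoperator and the Fisher information superoperator
      frame (rhoState d r s) =
        ((aPar d r s : ℝ) : ℂ) • P1 d r + ((bPar d r s : ℝ) : ℂ) • P2 d r
          + ((cPar d r s : ℝ) : ℂ) • P3 d r + diagSuper (Mmat d r s) ∧
      fisher (rhoState d r s) =
        ((aPar d r s : ℝ) : ℂ) • P1 d r + ((bPar d r s : ℝ) : ℂ) • P2 d r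
          + ((cPar d r s : ℝ) : ℂ) • P3 d r + diagSuper (Mbar d r s) ∧
      -- the spectrum of `M̄`; the factor `X` belongs to the all-ones vector
      (Mbar d r s).IsSymm ∧
      (Mbar d r s).charpoly =
        Polynomial.X * (Polynomial.X - Polynomial.C (aPar d r s)) ^ (r - 1)
          * (Polynomial.X - Polynomial.C (cPar d r s)) ^ (d - r - 1)
          * (Polynomial.X - Polynomial.C (betaPar d r s)) ∧
      -- the `E_{jk}^±` are common eigenvectors
      (∀ j k : Fin d, j ≠ k →
        frame (rhoState d r s) (Eplus j k) = ((blockVal d r s j k : ℝ) : ℂ) • Eplus j k ∧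
        frame (rhoState d r s) (Eminus j k) = ((blockVal d r s j k : ℝ) : ℂ) • Eminus j k ∧
        fisher (rhoState d r s) (Eplus j k) = ((blockVal d r s j k : ℝ) : ℂ) • Eplus j k ∧
        fisher (rhoState d r s) (Eminus j k) = ((blockVal d r s j k : ℝ) : ℂ) • Eminus j k) ∧
      -- `F̄` is Hermitian, kills the identity, preserves the traceless Hermitian operators and has
      -- the stated eigenvalues, with multiplicity, there
      (∀ X Y : Op d, (Xᴴ * fisher (rhoState d r s) Y).trace
        = ((fisher (rhoState d r s) X)ᴴ * Y).trace) ∧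
      fisher (rhoState d r s) 1 = 0 ∧
      (∀ X ∈ tracelessHerm d, fisher (rhoState d r s) X ∈ tracelessHerm d) ∧
      (restrictTH (fisher (rhoState d r s))).charpoly =
        (Polynomial.X - Polynomial.C (aPar d r s)) ^ (r ^ 2 - 1)
          * (Polynomial.X - Polynomial.C (bPar d r s)) ^ (2 * r * (d - r))
          * (Polynomial.X - Polynomial.C (cPar d r s)) ^ ((d - r) ^ 2 - 1)
          * (Polynomial.X - Polynomial.C (betaPar d r s)) ∧
      -- the scaled MSE
      scaledMSE (rhoState d r s) =
        ((r : ℝ) ^ 2 - 1) / aPar d r s + 2 * r * ((d : ℝ) - r) / bPar d r s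
          + (((d : ℝ) - r) ^ 2 - 1) / cPar d r s + 1 / betaPar d r s ∧
      -- the scaled MSB
      scaledMSB (rhoState d r s) =
        (1 / 4) * (((r : ℝ) ^ 2 - 1) / (aPar d r s * lam1 d r s)
          + 4 * r * ((d : ℝ) - r) / (bPar d r s * (lam1 d r s + lam2 d s))
          + (((d : ℝ) - r) ^ 2 - 1) / (cPar d r s * lam2 d s)
          + ((d : ℝ) - r) / (d * betaPar d r s * lam1 d r s)
          + r / (d * betaPar d r s * lam2 d s)) ∧
      -- the volume of the scaled uncertainty ellipsoid and its logarithm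
      ellipsoidVol (rhoState d r s) =
        ballVol d * (aPar d r s ^ (r ^ 2 - 1) * bPar d r s ^ (2 * r * (d - r))
          * cPar d r s ^ ((d - r) ^ 2 - 1) * betaPar d r s) ^ (-(1 / 2) : ℝ) ∧
      Real.log (ellipsoidVol (rhoState d r s)) =
        Real.log (ballVol d) - (1 / 2) * (((r : ℝ) ^ 2 - 1) * Real.log (aPar d r s)
          + 2 * r * ((d : ℝ) - r) * Real.log (bPar d r s)
          + (((d : ℝ) - r) ^ 2 - 1) * Real.log (cPar d r s)
          + Real.log (betaPar d r s))) ∧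
    -- the integral by which the `g_{jk}` are evaluated
    (∀ (m : ℕ) (u : ℝ), 0 < u →
      ∫ α in (0 : ℝ)..(Real.pi / 2),
          Real.cos α * Real.sin α ^ (2 * m + 1) / (Real.cos α ^ 2 + u) =
        (1 / 2) * (1 + u) ^ m * Real.log ((1 + u) / u)
          - (1 / 2) * ∑ n ∈ Finset.range m, (1 + u) ^ n / ((m : ℝ) - n)) ∧
    -- the limit `s → 1`
    (2 ≤ r →
      Tendsto (fun s => aPar d r s) (𝓝[<] 1) (𝓝 ((r : ℝ) / (r + 1))) ∧
      Tendsto (fun s => bPar d r s) (𝓝[<] 1) (𝓝 1) ∧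
      Tendsto (fun s => cPar d r s) (𝓝[<] 1) (𝓝 ((r : ℝ) / (r - 1))) ∧
      Tendsto (fun s => scaledMSE (rhoState d r s)) (𝓝[<] 1)
        (𝓝 ((d : ℝ) ^ 2 + 2 * d - 1 - (d : ℝ) ^ 2 / r - 1 / r))) := by
  refine ⟨fun s hs0 hs1 => ?_, fun m u hu => integral_cos_mul_sin_pow_div hu m, fun hr2 =>
    ⟨tendsto_aPar hr hrd, tendsto_bPar hr hrd, tendsto_cPar hr2 hrd, tendsto_scaledMSE hr2 hrd⟩⟩
  have hframe := frame_rhoState hr hrd hs0 hs1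
  have hfisher := fisher_rhoState hr hrd hs0 hs1
  have hspectral := fisher_rhoState_eq_spectralSuper hr hrd hs0 hs1
  refine ⟨⟨g_pos hr hrd hs0 hs1 rfl, g_pos hr hrd hs0 hs1 rfl, g_pos hr hrd hs0 hs1 rfl,
      betaPar_pos hr hrd hs0 hs1⟩, isUnit_frame_rhoState hr hrd hs0 hs1,
    hframe.trans (schurSuper_blockVal_eq s _), hfisher.trans (schurSuper_blockVal_eq s _),
    isSymm_Mbar hr hrd s, charpoly_Mbar hr hrd s, fun j k hjk => ?_, ?_, ?_, fun X hX => ?_,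
    charpoly_restrictTH_fisher_rhoState hr hrd hs0 hs1, scaledMSE_rhoState hr hrd hs0 hs1,
    scaledMSB_rhoState hr hrd hs0 hs1, ellipsoidVol_rhoState hr hrd hs0 hs1,
    log_ellipsoidVol_rhoState hr hrd hs0 hs1⟩
  · have hv := blockVal_comm (r := r) (s := s) k j
    rw [hframe, hfisher]
    exact ⟨schurSuper_Eplus _ hjk hv, schurSuper_Eminus _ hjk hv, schurSuper_Eplus _ hjk hv,
      schurSuper_Eminus _ hjk hv⟩
  · rw [hfisher]
    exact trace_conjTranspose_mul_schurSuper _ (isSymm_Mbar hr hrd s)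
  · rw [hspectral]
    exact spectralSuper_apply_one d r _
  · rw [hspectral]
    exact spectralSuper_mem_tracelessHerm _ hX.1
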